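/- **Setting.** All operators act on finite dimensional complex Hilbert spaces. For positive operators $\rho,\sigma$ let $\operatorname{supp}\rho=(\ker\rho)^\perp$. Write $\rho\ll\sigma$ (or $\sigma\gg\rho$) if the compression of $\sigma$ to $\operatorname{supp}\rho$ is strictly positive, and $\rho\perp\sigma$ if that compression is $0$. A *quantum Lebesgue decomposition* of $\sigma$ with respect to $\rho$ is $\sigma=\sigma^a+\sigma^\perp$ with $\sigma^a,\sigma^\perp\ge 0$, $\sigma^a\ll\rho$ and $\sigma^\perp\perp\rho$. A *(version of the) quantum log-likelihood ratio* $\mathcal L(\sigma|\rho)$ is a Hermitian operator $\mathcal L$ with $\sigma^a=e^{\mathcal L/2}\rho\,e^{\mathcal L/2}$; by convention $\mathcal L(\rho|\rho)=0$. For observables (Hermitian operators) $X^{(n)}=(X^{(n)}_1,\dots,X^{(n)}_d)$ and density operators $\rho^{(n)}$ on $\mathcal H^{(n)}$, write $X^{(n)}\to N(0,J)$ under $\rho^{(n)}$ if for all $r$ and all $\xi_1,\dots,\xi_r\in\mathbb C^d$ $$\lim_{n\to\infty}\operatorname{Tr}\rho^{(n)}\prod_{t=1}^r e^{\sqrt{-1}\sum_i\xi_t^iX_i^{(n)}}=\exp\Big(-\tfrac12\sum_{t}\sum_{i,j}\xi_t^i\xi_t^jJ_{ji}-\sum_{t<u}\sum_{i,j}\xi_t^i\xi_u^jJ_{ji}\Big),$$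 the right-hand side being the quasi-characteristic function of the quantum Gaussian state $N(0,J)$. A sequence $R^{(n)}$ of observables is *infinitesimal*, $R^{(n)}=o(X^{(n)},\rho^{(n)})$, if for all $r$, $\xi_t\in\mathbb C^d$ and $\eta_t\in\mathbb C$ the limit of $\operatorname{Tr}\rho^{(n)}\prod_{t}e^{\sqrt{-1}(\sum_i\xi_t^iX_i^{(n)}+\eta_tR^{(n)})}$ is the same right-hand side. Let $\Theta\subset\mathbb R^d$ be open and $\theta_0\in\Theta$. Models $\{\rho^{(n)}_\theta\mid\theta\in\Theta\}$ of density operators on $\mathcal H^{(n)}$ are *q-LAN at $\theta_0$*, with observables $\Delta^{(n)}$ and a Hermitian positive semidefinite $d\times d$ matrix $J$, if (i) $\rho^{(n)}_\theta\gg\rho^{(n)}_{\theta_0}$ for all $\theta\in\Theta$ and all $n$; (ii) $\Delta^{(n)}\to N(0,J)$ under $\rho^{(n)}_{\theta_0}$, and $\operatorname{Re}J>0$; (iii) for (versions of) $\mathcal L^{(n)}_h=\mathcal L(\rho^{(n)}_{\theta_0+h/\sqrt n}|\rho^{(n)}_{\theta_0})$ and every $h\in\mathbb R^d$, $$\mathcal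 L^{(n)}_h=\sum_i h^i\Delta^{(n)}_i-\tfrac12\Big(\sum_{i,j}J_{ij}h^ih^j\Big)I+o(\Delta^{(n)},\rho^{(n)}_{\theta_0}).$$ **Theorem (q-LAN for i.i.d. models).** Let $\{\rho_\theta\mid\theta\in\Theta\}$, $\Theta\subset\mathbb R^d$ open, be a family of density operators on a finite dimensional Hilbert space $\mathcal H$, let $\theta_0\in\Theta$, and suppose $\rho_\theta\gg\rho_{\theta_0}$ for all $\theta\in\Theta$. Let $\mathcal L_h$ be a version of $\mathcal L(\rho_{\theta_0+h}|\rho_{\theta_0})$ for each $h$ with $\theta_0+h\in\Theta$, such that $\mathcal L_0=0$, $h\mapsto\mathcal L_h$ is differentiable at $h=0$, and $$\operatorname{Tr}\rho_{\theta_0}e^{\mathcal L_h}=1-o(\|h\|^2)\qquad(h\to0).$$ Then: 1. For all $n$ and $\theta\in\Theta$, if $M$ is a version of $\mathcal L(\rho_\theta|\rho_{\theta_0})$, then $\sum_{k=1}^nI^{\otimes(k-1)}\otimes M\otimes I^{\otimes(n-k)}$ is a version of $\mathcal L(\rho_\theta^{\otimes n}|\rho_{\theta_0}^{\otimes n})$.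 2. The operator $\partial_{h^i}\mathcal L_h|_{h=0}$ is a version of the $i$th symmetric logarithmic derivative (SLD) of the model at $\theta_0$, that is, a Hermitian operator $L_i$ with $\partial_i\rho_\theta|_{\theta=\theta_0}=\tfrac12(\rho_{\theta_0}L_i+L_i\rho_{\theta_0})$. 3. Let $L_1,\dots,L_d$ be any versions of the SLDs at $\theta_0$, and put $$\Delta^{(n)}_i=\frac1{\sqrt n}\sum_{k=1}^nI^{\otimes(k-1)}\otimes L_i\otimes I^{\otimes(n-k)},\qquad J_{ij}=\operatorname{Tr}\rho_{\theta_0}L_jL_i .$$ Then $J$ is Hermitian and positive semidefinite, and $\{\rho_\theta^{\otimes n}\}$ satisfies all the requirements of q-LAN at $\theta_0$ with these $\Delta^{(n)}$ and $J$, except possibly $\operatorname{Re}J>0$; the expansion (iii) holds for the versions $\mathcal L^{(n)}_h=\sum_{k=1}^nI^{\otimes(k-1)}\otimes\mathcal L_{h/\sqrt n}\otimes I^{\otimes(n-k)}$. It is q-LAN at $\theta_0$ with these $\Delta^{(n)}$ and $J$ (that is, also $\operatorname{Re}J>0$) if and only if the partial derivatives $\partial_1\rho_\theta,\dots,\partial_d\rho_\theta$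 at $\theta=\theta_0$ are linearly independent over $\mathbb R$. -/

import Mathlib

open scoped ComplexOrder Matrix Topology

noncomputable section

namespace QLAN

/-- The parameter space `ℝ^d`. -/
abbrev Param (d : ℕ) : Type := EuclideanSpace ℝ (Fin d)

/-! Operators on a finite dimensional Hilbert space are complex square matrices with respect to an
orthonormal basis indexed by a finite type. -/

section Operators

variable {D : Type*} [Fintype D] [DecidableEq D]

/-- Density operators: positive operators of trace one. -/
def IsDensity (ρ : Matrix D D ℂ) : Prop :=
  ρ.PosSemidef ∧ ρ.trace = 1

/-- The support `(ker ρ)^⊥` of an operator. -/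
def supp (ρ : Matrix D D ℂ) : Set (D → ℂ) :=
  {x | ∀ y : D → ℂ, ρ *ᵥ y = 0 → star y ⬝ᵥ x = 0}

/-- `ρ ≪ σ`: the excision of `σ` to `supp ρ` is strictly positive. -/
def AbsCont (ρ σ : Matrix D D ℂ) : Prop :=
  ∀ x ∈ supp ρ, x ≠ 0 → 0 < star x ⬝ᵥ (σ *ᵥ x)

/-- `ρ ⟂ σ`: the excision of `σ` to `supp ρ` vanishes. -/
def Singular (ρ σ : Matrix D D ℂ) : Prop :=
  ∀ x ∈ supp ρ, ∀ y ∈ supp ρ, star y ⬝ᵥ (σ *ᵥ x) = 0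

/-- `σ = σa + σs` is a quantum Lebesgue decomposition of `σ` with respect to `ρ`: both parts are
positive, `σa ≪ ρ` and `σs ⟂ ρ`. -/
structure IsLebesgueDecomp (ρ σ σa σs : Matrix D D ℂ) : Prop where
  eq_add : σ = σa + σs
  posSemidef_ac : σa.PosSemidef
  posSemidef_sing : σs.PosSemidef
  absCont : AbsCont σa ρ
  singular : Singular σs ρ

/-- `L` is (a version of) the quantum log-likelihood ratio `𝓛(σ | ρ)`: a Hermitian operator with
`σa = e^{L/2} ρ e^{L/2}`, where `σa` is the absolutely continuous part of `σ` with respect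
to `ρ`. -/
def IsLogLikelihoodRatio (σ ρ L : Matrix D D ℂ) : Prop :=
  L.IsHermitian ∧ ∃ σa σs : Matrix D D ℂ, IsLebesgueDecomp ρ σ σa σs ∧
    σa = NormedSpace.exp ((1 / 2 : ℂ) • L) * ρ * NormedSpace.exp ((1 / 2 : ℂ) • L)

end Operators

section TensorPowers

variable {D : Type*} [Fintype D] [DecidableEq D]

/-- The tensor product `A₁ ⊗ ⋯ ⊗ Aₙ`, as an operator on the `n`-fold tensor power of `ℂ^D`, whose
product orthonormal basis is indexed by `Fin n → D`. -/
def tensor {n : ℕ} (A : Fin n → Matrix D D ℂ) : Matrix (Fin n → D) (Fin n → D) ℂ :=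
  Matrix.of fun x y => ∏ k, A k (x k) (y k)

/-- The tensor power `A^{⊗ n}`. -/
def tensorPow (n : ℕ) (A : Matrix D D ℂ) : Matrix (Fin n → D) (Fin n → D) ℂ :=
  tensor fun _ => A

/-- `∑ₖ I^{⊗ (k-1)} ⊗ A ⊗ I^{⊗ (n-k)}`. -/
def siteSum (n : ℕ) (A : Matrix D D ℂ) : Matrix (Fin n → D) (Fin n → D) ℂ :=
  ∑ k : Fin n, tensor (Function.update (fun _ => (1 : Matrix D D ℂ)) k A)

/-- `n^{-1/2} ∑ₖ I^{⊗ (k-1)} ⊗ A ⊗ I^{⊗ (n-k)}`. -/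
def normalizedSum (n : ℕ) (A : Matrix D D ℂ) : Matrix (Fin n → D) (Fin n → D) ℂ :=
  (((Real.sqrt n)⁻¹ : ℝ) : ℂ) • siteSum n A

end TensorPowers

section Models

variable {d : ℕ} {D : Type*} [Fintype D] [DecidableEq D]

/-- The curve `t ↦ ρ_{θ₀ + t eᵢ}` through `ρ_{θ₀}` in the `i`th coordinate direction. -/
def coordCurve (ρ : Param d → Matrix D D ℂ) (θ₀ : Param d) (i : Fin d) (t : ℝ) : Matrix D D ℂ :=
  ρ (θ₀ + t • EuclideanSpace.single i (1 : ℝ))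

/-- `A` is (a version of) the `i`th symmetric logarithmic derivative of the model at `θ₀`:
it is Hermitian and `∂ᵢ ρ = (ρ A + A ρ) / 2` at `θ₀`. -/
def IsSLD (ρ : Param d → Matrix D D ℂ) (θ₀ : Param d) (i : Fin d) (A : Matrix D D ℂ) : Prop :=
  A.IsHermitian ∧
    HasDerivAt (coordCurve ρ θ₀ i) ((1 / 2 : ℂ) • (ρ θ₀ * A + A * ρ θ₀)) (0 : ℝ)

/-- `J i j = Tr ρ Aⱼ Aᵢ`. -/
def covMatrix (ρ₀ : Matrix D D ℂ) (A : Fin d → Matrix D D ℂ) : Matrix (Fin d) (Fin d) ℂ :=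
  Matrix.of fun i j => (ρ₀ * A j * A i).trace

end Models

section Convergence

/-- The quasi-characteristic function `φ(∏ₜ e^{√-1 ξₜ^i Xᵢ})` of the quantum Gaussian state
`(X, φ) ∼ N(m, J)`. -/
def gaussianQuasiChar {d : ℕ} (m : Fin d → ℝ) (J : Matrix (Fin d) (Fin d) ℂ)
    {r : ℕ} (ξ : Fin r → Fin d → ℂ) : ℂ :=
  Complex.exp
    ((∑ t, (Complex.I * (∑ i, ξ t i * (m i : ℂ)) - (1 / 2) * ∑ i, ∑ j, ξ t i * ξ t j * J j i))
      - ∑ t, ∑ u ∈ Finset.Ioi t, ∑ i, ∑ j, ξ t i * ξ u j * J j i)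

variable {d : ℕ} {D : ℕ → Type*} [∀ n, Fintype (D n)] [∀ n, DecidableEq (D n)]

/-- Convergence in law of the observables `X n` under the states `ρ n` to `N(m, J)`. -/
def ConvergesInLaw (X : ∀ n, Fin d → Matrix (D n) (D n) ℂ) (ρ : ∀ n, Matrix (D n) (D n) ℂ)
    (m : Fin d → ℝ) (J : Matrix (Fin d) (Fin d) ℂ) : Prop :=
  ∀ (r : ℕ) (ξ : Fin r → Fin d → ℂ),
    Filter.Tendsto
      (fun n => (ρ n * (List.ofFn fun t : Fin r =>
        NormedSpace.exp (Complex.I • ∑ i, ξ t i • X n i)).prod).trace)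
      Filter.atTop (𝓝 (gaussianQuasiChar m J ξ))

/-- The sequence `R n` is infinitesimal relative to the convergence in law of `X n` under `ρ n`
to `N(0, J)`. -/
def IsInfinitesimal (X : ∀ n, Fin d → Matrix (D n) (D n) ℂ) (ρ : ∀ n, Matrix (D n) (D n) ℂ)
    (J : Matrix (Fin d) (Fin d) ℂ) (R : ∀ n, Matrix (D n) (D n) ℂ) : Prop :=
  ∀ (r : ℕ) (ξ : Fin r → Fin d → ℂ) (η : Fin r → ℂ),
    Filter.Tendsto
      (fun n => (ρ n * (List.ofFn fun t : Fin r =>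
        NormedSpace.exp (Complex.I • (∑ i, ξ t i • X n i + η t • R n))).prod).trace)
      Filter.atTop (𝓝 (gaussianQuasiChar 0 J ξ))

/-- The local parameter point `θ₀ + h / √n`. -/
def localPoint (θ₀ : Param d) (n : ℕ) (h : Param d) : Param d :=
  θ₀ + (Real.sqrt n)⁻¹ • h

/-- The requirements of quantum local asymptotic normality at `θ₀` for the observables `Δ n`, the
covariance matrix `J` and the versions `L n h` of the quantum log-likelihood ratios
`𝓛(ρ n (θ₀ + h / √n) | ρ n θ₀)`, except for the nondegeneracy of `J`. -/
structure HasQLANExpansion (Θ : Set (Param d)) (θ₀ : Param d)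
    (ρ : ∀ n, Param d → Matrix (D n) (D n) ℂ)
    (Δ : ∀ n, Fin d → Matrix (D n) (D n) ℂ) (J : Matrix (Fin d) (Fin d) ℂ)
    (L : ∀ n, Param d → Matrix (D n) (D n) ℂ) : Prop where
  isOpen : IsOpen Θ
  mem : θ₀ ∈ Θ
  density : ∀ n, ∀ θ ∈ Θ, IsDensity (ρ n θ)
  absCont : ∀ n, ∀ θ ∈ Θ, AbsCont (ρ n θ₀) (ρ n θ)
  observable : ∀ n i, (Δ n i).IsHermitian
  posSemidef : J.PosSemidef
  convergesInLaw : ConvergesInLaw Δ (fun n => ρ n θ₀) 0 J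
  logLikelihoodRatio : ∀ n h, localPoint θ₀ n h ∈ Θ →
    IsLogLikelihoodRatio (ρ n (localPoint θ₀ n h)) (ρ n θ₀) (L n h)
  /-- The convention `𝓛(ρ | ρ) = 0` at the reference point. -/
  logLikelihoodRatio_zero : ∀ n, L n 0 = 0
  expansion : ∀ h : Param d, IsInfinitesimal Δ (fun n => ρ n θ₀) J fun n =>
    L n h - ((∑ i, (h i : ℂ) • Δ n i)
      - ((1 / 2 : ℂ) * ∑ i, ∑ j, J i j * (h i : ℂ) * (h j : ℂ)) • (1 : Matrix (D n) (D n) ℂ))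

/-- The sequence of models `ρ n` is quantum locally asymptotically normal (q-LAN) at `θ₀`, with
observables `Δ n`, covariance `J` and log-likelihood ratios `L n h`. -/
structure IsQLAN (Θ : Set (Param d)) (θ₀ : Param d)
    (ρ : ∀ n, Param d → Matrix (D n) (D n) ℂ)
    (Δ : ∀ n, Fin d → Matrix (D n) (D n) ℂ) (J : Matrix (Fin d) (Fin d) ℂ)
    (L : ∀ n, Param d → Matrix (D n) (D n) ℂ) : Prop
    extends HasQLANExpansion Θ θ₀ ρ Δ J L where
  posDef_re : (J.map Complex.re).PosDef

end Convergence

end QLAN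

end

open scoped ComplexOrder Matrix Topology

noncomputable section

set_option linter.unusedSectionVars false

namespace QLAN

/-! ### Tensor products, site sums and their exponentials -/

section TensorAlgebra

variable {D : Type*}

/-! The exponential of a site sum is a tensor power (`exp_siteSum`), so each quasi-characteristic
function under `ρ^{⊗ n}` is the `n`th power of a one-site number `Tr ρ ∏ₜ exp (Yₜ)` with `Yₜ` of
order `n^{-1/2}`. If the linear terms have expectation `o(1/n)`, a second order expansion gives `1 +
q/n + o(1/n)`, and the powers tend to `e^q`; here `q` is the expectation of the quadratic terms,
which is the Gaussian exponent (`tendsto_map_prod_exp_pow`, `isInfinitesimal_siteSum`).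

For `n > 0` the remainder of the log-likelihood expansion is itself a site sum, of `V n = L (h/√n) -
n^{-1/2} ∑ hᵢ Aᵢ + (c/2n) I` with `c = ∑ Jᵢⱼ hᵢ hⱼ`. Its coefficient `W` at order `n^{-1/2}` is a
difference of SLD versions, so `ρ W = W ρ = 0` and `W` leaves `q` unchanged. The trace condition
yields `Tr ρ L h = -½ Tr ρ (dL h)² + o(‖h‖²)`, which the constant `c/2n` cancels: `Tr ρ (V n) =
o(1/n)`.

That `dL` gives SLDs holds because the singular part is positive with trace `1 - Tr ρ e^L =
o(‖h‖²)`: only `e^{L/2} ρ e^{L/2}` contributes to the derivative. Finally, for `X = ∑ xᵢ Aᵢ` with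
real `x`, the form `xᵀ (Re J) x = Tr ρ X²` vanishes exactly when `ρ X + X ρ = 0`, which gives the
criterion for `Re J > 0`. -/

theorem tensor_mul_tensor [Fintype D] {n : ℕ} (A B : Fin n → Matrix D D ℂ) :
    tensor A * tensor B = tensor fun k => A k * B k := by
  ext x y
  simp only [tensor, Matrix.mul_apply, Matrix.of_apply, Finset.prod_univ_sum,
    Fintype.piFinset_univ, Finset.prod_mul_distrib]

theorem tensor_one [DecidableEq D] (n : ℕ) :
    tensor (fun _ : Fin n => (1 : Matrix D D ℂ)) = 1 := by
  ext x y
  simp only [tensor, Matrix.of_apply, Matrix.one_apply, Finset.prod_ite_zero,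
    Finset.prod_const_one, Finset.mem_univ, true_implies, funext_iff]

theorem trace_tensor [Fintype D] {n : ℕ} (A : Fin n → Matrix D D ℂ) :
    (tensor A).trace = ∏ k, (A k).trace := by
  simp only [tensor, Matrix.trace, Matrix.diag, Matrix.of_apply, Finset.prod_univ_sum,
    Fintype.piFinset_univ]

theorem conjTranspose_tensor {n : ℕ} (A : Fin n → Matrix D D ℂ) :
    (tensor A)ᴴ = tensor fun k => (A k)ᴴ := by
  ext x y
  simp [tensor, Matrix.conjTranspose_apply]

/-- Multilinearity; `s` is the set of sites that take their factor from `A`. -/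
theorem tensor_add_eq_sum {n : ℕ} (A B : Fin n → Matrix D D ℂ) :
    (tensor fun k => A k + B k) = ∑ s : Finset (Fin n), tensor (s.piecewise A B) := by
  ext x y
  simp only [tensor, Matrix.of_apply, Matrix.sum_apply, Matrix.add_apply, Finset.prod_add,
    Finset.powerset_univ]
  refine Finset.sum_congr rfl fun s _ => ?_
  have h : ∀ k, s.piecewise A B k (x k) (y k)
      = s.piecewise (fun k => A k (x k) (y k)) (fun k => B k (x k) (y k)) k := by
    intro k
    by_cases hk : k ∈ s <;> simp [hk]
  simp only [h, Finset.prod_piecewise, Finset.univ_inter]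

open scoped MatrixOrder in
theorem posSemidef_tensor [Fintype D] [DecidableEq D] {n : ℕ} {A : Fin n → Matrix D D ℂ}
    (hA : ∀ k, (A k).PosSemidef) : (tensor A).PosSemidef := by
  choose C hC using fun k => CStarAlgebra.nonneg_iff_eq_star_mul_self.mp (hA k).nonneg
  have h : tensor A = (tensor C)ᴴ * tensor C := by
    rw [conjTranspose_tensor, tensor_mul_tensor]
    exact congrArg tensor (funext hC)
  rw [h]
  exact Matrix.posSemidef_conjTranspose_mul_self _

theorem tensorPow_mul [Fintype D] (n : ℕ) (A B : Matrix D D ℂ) :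
    tensorPow n (A * B) = tensorPow n A * tensorPow n B :=
  (tensor_mul_tensor _ _).symm

theorem trace_tensorPow [Fintype D] (n : ℕ) (A : Matrix D D ℂ) :
    (tensorPow n A).trace = A.trace ^ n := by
  simp [tensorPow, trace_tensor]

theorem IsDensity.tensorPow [Fintype D] [DecidableEq D] {ρ : Matrix D D ℂ} (h : IsDensity ρ)
    (n : ℕ) : IsDensity (tensorPow n ρ) :=
  ⟨posSemidef_tensor fun _ => h.1, by rw [trace_tensorPow, h.2, one_pow]⟩

/-- The multilinear expansion without its all-`A` term is a sum of mixed tensor products of positive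
operators. This gives positivity of the singular part of a tensor power. -/
theorem posSemidef_tensorPow_add_sub [Fintype D] [DecidableEq D] (n : ℕ) {A B : Matrix D D ℂ}
    (hA : A.PosSemidef) (hB : B.PosSemidef) :
    (tensorPow n (A + B) - tensorPow n A).PosSemidef := by
  have h : tensorPow n (A + B) - tensorPow n A
      = ∑ s ∈ Finset.univ.erase (Finset.univ : Finset (Fin n)),
        tensor (s.piecewise (fun _ => A) fun _ => B) := by
    rw [Finset.sum_erase_eq_sub (Finset.mem_univ _), ← tensor_add_eq_sum]
    simp [tensorPow]
  rw [h]
  refine Matrix.posSemidef_sum _ fun s _ => posSemidef_tensor fun k => ?_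
  by_cases hk : k ∈ s <;> simp [hk, hA, hB]

variable [DecidableEq D]

theorem tensor_update_one_apply {n : ℕ} (k : Fin n) (A : Matrix D D ℂ) (x y : Fin n → D) :
    tensor (Function.update (fun _ => (1 : Matrix D D ℂ)) k A) x y
      = A (x k) (y k) * ∏ j ∈ Finset.univ.erase k, (1 : Matrix D D ℂ) (x j) (y j) := by
  rw [tensor, Matrix.of_apply, ← Finset.mul_prod_erase _ _ (Finset.mem_univ k),
    Function.update_self]
  congr 1
  refine Finset.prod_congr rfl fun j hj => ?_
  rw [Function.update_of_ne (Finset.ne_of_mem_erase hj)]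

variable [Fintype D]

/-- The embedding `A ↦ I ⊗ ⋯ ⊗ A ⊗ ⋯ ⊗ I` of the operators at site `k`. -/
def siteHom {n : ℕ} (k : Fin n) :
    Matrix D D ℂ →ₐ[ℂ] Matrix (Fin n → D) (Fin n → D) ℂ :=
  AlgHom.ofLinearMap
    { toFun := fun A => tensor (Function.update (fun _ => (1 : Matrix D D ℂ)) k A)
      map_add' := fun A B => by
        ext x y
        simp only [tensor_update_one_apply, Matrix.add_apply, add_mul]
      map_smul' := fun c A => by
        ext x y
        simp only [tensor_update_one_apply, Matrix.smul_apply, smul_mul_assoc, RingHom.id_apply] }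
    (by
      change tensor (Function.update (fun _ => (1 : Matrix D D ℂ)) k 1) = 1
      rw [Function.update_eq_self_iff.2 rfl, tensor_one])
    (by
      intro A B
      change tensor (Function.update (fun _ => (1 : Matrix D D ℂ)) k (A * B))
        = tensor (Function.update (fun _ => (1 : Matrix D D ℂ)) k A)
          * tensor (Function.update (fun _ => (1 : Matrix D D ℂ)) k B)
      rw [tensor_mul_tensor]
      congr 1
      ext1 j
      by_cases hj : j = k
      · subst hj; simp
      · simp [hj])

theorem siteHom_apply {n : ℕ} (k : Fin n) (A : Matrix D D ℂ) :
    siteHom k A = tensor (Function.update (fun _ => (1 : Matrix D D ℂ)) k A) := rfl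

/-- `siteSum` as a linear map. -/
def siteSumLinear (n : ℕ) : Matrix D D ℂ →ₗ[ℂ] Matrix (Fin n → D) (Fin n → D) ℂ :=
  ∑ k : Fin n, (siteHom k).toLinearMap

theorem siteSumLinear_apply (n : ℕ) (A : Matrix D D ℂ) : siteSumLinear n A = siteSum n A := by
  simp [siteSumLinear, siteSum, siteHom_apply]

theorem siteSum_eq_sum_siteHom (n : ℕ) (A : Matrix D D ℂ) :
    siteSum n A = ∑ k : Fin n, siteHom k A := rfl

theorem siteSum_one (n : ℕ) : siteSum n (1 : Matrix D D ℂ) = (n : ℂ) • 1 := by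
  simp [siteSum_eq_sum_siteHom, Nat.cast_smul_eq_nsmul]

theorem commute_siteHom {n : ℕ} {k l : Fin n} (h : k ≠ l) (A B : Matrix D D ℂ) :
    Commute (siteHom k A) (siteHom l B) := by
  rw [Commute, SemiconjBy, siteHom_apply, siteHom_apply, tensor_mul_tensor, tensor_mul_tensor]
  congr 1
  ext1 j
  by_cases hk : j = k
  · subst hk; simp [h]
  · simp [hk]

theorem isHermitian_siteSum (n : ℕ) {A : Matrix D D ℂ} (hA : A.IsHermitian) :
    (siteSum n A).IsHermitian := by
  rw [Matrix.IsHermitian, siteSum, Matrix.conjTranspose_sum]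
  refine Finset.sum_congr rfl fun k _ => ?_
  rw [conjTranspose_tensor]
  congr 1
  ext1 j
  by_cases hj : j = k
  · subst hj; simp [hA.eq]
  · simp [hj]

open scoped Matrix.Norms.Operator in
theorem exp_siteHom {n : ℕ} (k : Fin n) (A : Matrix D D ℂ) :
    NormedSpace.exp (siteHom k A) = siteHom k (NormedSpace.exp A) :=
  (NormedSpace.map_exp (siteHom k)
    (LinearMap.continuous_of_finiteDimensional (siteHom k).toLinearMap) A).symm

/-- Operators at distinct sites commute, so sites can be added one at a time. -/
theorem exp_sum_siteHom {n : ℕ} (A : Matrix D D ℂ) (s : Finset (Fin n)) :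
    NormedSpace.exp (∑ k ∈ s, siteHom k A)
      = tensor (s.piecewise (fun _ => NormedSpace.exp A) fun _ => 1) := by
  induction s using Finset.induction_on with
  | empty => simpa using (tensor_one n).symm
  | insert k s hk ih =>
    rw [Finset.sum_insert hk, Matrix.exp_add_of_commute, ih, exp_siteHom, siteHom_apply,
      tensor_mul_tensor]
    · congr 1
      ext1 j
      by_cases hj : j = k
      · subst hj; simp [hk]
      · by_cases hs : j ∈ s <;> simp [hj, hs]
    · exact Commute.sum_right _ _ _ fun j hj => commute_siteHom (by rintro rfl; exact hk hj) _ _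

theorem exp_siteSum (n : ℕ) (A : Matrix D D ℂ) :
    NormedSpace.exp (siteSum n A) = tensorPow n (NormedSpace.exp A) := by
  rw [siteSum_eq_sum_siteHom, exp_sum_siteHom]
  simp [tensorPow]

theorem prod_exp_siteSum (n : ℕ) {r : ℕ} (Y : Fin r → Matrix D D ℂ) :
    (List.ofFn fun t => NormedSpace.exp (siteSum n (Y t))).prod
      = tensorPow n (List.ofFn fun t => NormedSpace.exp (Y t)).prod := by
  induction r with
  | zero => simpa [tensorPow] using (tensor_one n).symm
  | succ r ih =>
    rw [List.ofFn_succ, List.prod_cons, ih, List.ofFn_succ, List.prod_cons, tensorPow_mul,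
      exp_siteSum]

end TensorAlgebra

/-! ### Lebesgue decompositions, log-likelihood ratios and covariance matrices -/

section Operators

variable {D : Type*} [Fintype D] [DecidableEq D]

theorem isHermitian_half {L : Matrix D D ℂ} (hL : L.IsHermitian) :
    ((1 / 2 : ℂ) • L).IsHermitian := by
  rw [Matrix.IsHermitian, Matrix.conjTranspose_smul, hL.eq]
  simp

theorem exp_half_mul_exp_half (L : Matrix D D ℂ) :
    NormedSpace.exp ((1 / 2 : ℂ) • L) * NormedSpace.exp ((1 / 2 : ℂ) • L)
      = NormedSpace.exp L := by
  rw [← Matrix.exp_add_of_commute _ _ (Commute.refl _), ← add_smul]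
  norm_num

theorem posDef_exp {L : Matrix D D ℂ} (hL : L.IsHermitian) : (NormedSpace.exp L).PosDef := by
  have h : NormedSpace.exp L
      = (NormedSpace.exp ((1 / 2 : ℂ) • L))ᴴ * NormedSpace.exp ((1 / 2 : ℂ) • L) := by
    rw [(isHermitian_half hL).exp.eq, exp_half_mul_exp_half]
  rw [h]
  exact Matrix.PosDef.conjTranspose_mul_self _
    (Matrix.mulVec_injective_iff_isUnit.2 (Matrix.isUnit_exp _))

theorem star_dotProduct_mulVec_of_isHermitian {A : Matrix D D ℂ} (hA : A.IsHermitian)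
    (x y : D → ℂ) : star (A *ᵥ x) ⬝ᵥ y = star x ⬝ᵥ (A *ᵥ y) := by
  rw [Matrix.star_mulVec, hA.eq, Matrix.dotProduct_mulVec]

theorem mulVec_mem_supp {A : Matrix D D ℂ} (hA : A.IsHermitian) (x : D → ℂ) :
    A *ᵥ x ∈ supp A := by
  intro y hy
  rw [← star_dotProduct_mulVec_of_isHermitian hA, hy, star_zero, zero_dotProduct]

/-- An operator of the form `E ρ E` is absolutely continuous with respect to `ρ`. -/
theorem absCont_conj {E ρ : Matrix D D ℂ} (hE : E.PosDef) (hρ : ρ.PosSemidef) :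
    AbsCont (E * ρ * E) ρ := by
  intro x hx hx0
  refine lt_of_le_of_ne (hρ.dotProduct_mulVec_nonneg x) fun h => ?_
  have h0 : ρ *ᵥ x = 0 := (hρ.dotProduct_mulVec_zero_iff x).1 h.symm
  -- If `ρ x = 0`, then `x`, lying in the support of `E ρ E`, is orthogonal to `E⁻¹ x`; this
  -- contradicts `E⁻¹ > 0`.
  have h1 : (E * ρ * E) *ᵥ (E⁻¹ *ᵥ x) = 0 := by
    rw [Matrix.mulVec_mulVec, Matrix.mul_assoc, Matrix.mul_nonsing_inv _
      ((Matrix.isUnit_iff_isUnit_det _).1 hE.isUnit), Matrix.mul_one, ← Matrix.mulVec_mulVec, h0,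
      Matrix.mulVec_zero]
  have h2 := hx _ h1
  rw [star_dotProduct_mulVec_of_isHermitian hE.inv.isHermitian] at h2
  exact (hE.inv.dotProduct_mulVec_pos hx0).ne' h2

/-- `ρ` is absolutely continuous with respect to any operator above `E ρ E`. -/
theorem absCont_conj_add {E ρ P : Matrix D D ℂ} (hE : E.PosDef) (hρ : ρ.PosSemidef)
    (hP : P.PosSemidef) : AbsCont ρ (E * ρ * E + P) := by
  intro x hx hx0
  rw [Matrix.add_mulVec, dotProduct_add]
  refine lt_of_lt_of_le ?_ (le_add_of_nonneg_right (hP.dotProduct_mulVec_nonneg x))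
  have h : star x ⬝ᵥ ((E * ρ * E) *ᵥ x) = star (E *ᵥ x) ⬝ᵥ (ρ *ᵥ (E *ᵥ x)) := by
    rw [star_dotProduct_mulVec_of_isHermitian hE.isHermitian, Matrix.mulVec_mulVec,
      Matrix.mulVec_mulVec, Matrix.mul_assoc]
  rw [h]
  refine lt_of_le_of_ne (hρ.dotProduct_mulVec_nonneg _) fun h => ?_
  have h0 := hx _ ((hρ.dotProduct_mulVec_zero_iff _).1 h.symm)
  rw [star_dotProduct_mulVec_of_isHermitian hE.isHermitian] at h0
  exact (hE.dotProduct_mulVec_pos hx0).ne' h0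

/-- The range of `σ` lies in its support, and a positive form that vanishes at a vector annihilates
it, so singularity gives `ρ σ = 0`. Conversely `σ ρ = 0` puts the range of `ρ` in `ker σ`. The
algebraic form is the one that passes to tensor powers. -/
theorem singular_iff_mul_eq_zero {σ ρ : Matrix D D ℂ} (hσ : σ.IsHermitian) (hρ : ρ.PosSemidef) :
    Singular σ ρ ↔ σ * ρ = 0 := by
  constructor
  · intro h
    have h1 : ρ * σ = 0 := by
      refine Matrix.ext_of_mulVec_single fun i => ?_
      have := mulVec_mem_supp hσ (Pi.single i 1)
      rw [← Matrix.mulVec_mulVec, Matrix.zero_mulVec]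
      exact (hρ.dotProduct_mulVec_zero_iff _).1 (h _ this _ this)
    have h2 := congrArg Matrix.conjTranspose h1
    rwa [Matrix.conjTranspose_mul, hσ.eq, hρ.isHermitian.eq, Matrix.conjTranspose_zero] at h2
  · intro h x hx y _
    rw [← star_dotProduct_mulVec_of_isHermitian hρ.isHermitian]
    exact hx _ (by rw [Matrix.mulVec_mulVec, h, Matrix.zero_mulVec])

theorem exp_half_siteSum (n : ℕ) (M : Matrix D D ℂ) :
    NormedSpace.exp ((1 / 2 : ℂ) • siteSum n M)
      = tensorPow n (NormedSpace.exp ((1 / 2 : ℂ) • M)) := by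
  rw [← exp_siteSum, ← siteSumLinear_apply, ← siteSumLinear_apply, map_smul]

/-- Log-likelihood ratios are additive over tensor powers. -/
theorem IsLogLikelihoodRatio.siteSum {σ ρ M : Matrix D D ℂ} (hρ : ρ.PosSemidef)
    (h : IsLogLikelihoodRatio σ ρ M) (n : ℕ) :
    IsLogLikelihoodRatio (tensorPow n σ) (tensorPow n ρ) (siteSum n M) := by
  obtain ⟨hM, σa, σs, hd, hσa⟩ := h
  have hn : tensorPow n σa = NormedSpace.exp ((1 / 2 : ℂ) • QLAN.siteSum n M) * tensorPow n ρ
      * NormedSpace.exp ((1 / 2 : ℂ) • QLAN.siteSum n M) := by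
    rw [hσa, exp_half_siteSum, tensorPow_mul, tensorPow_mul]
  have hρn : (tensorPow n ρ).PosSemidef := posSemidef_tensor fun _ => hρ
  have hs : (tensorPow n σ - tensorPow n σa).PosSemidef := by
    rw [hd.eq_add]
    exact posSemidef_tensorPow_add_sub n hd.posSemidef_ac hd.posSemidef_sing
  refine ⟨isHermitian_siteSum n hM, tensorPow n σa, tensorPow n σ - tensorPow n σa,
    ⟨(add_sub_cancel _ _).symm, posSemidef_tensor fun _ => hd.posSemidef_ac, hs, ?_, ?_⟩, hn⟩
  · rw [hn]
    exact absCont_conj (posDef_exp (isHermitian_half (isHermitian_siteSum n hM))) hρn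
  -- From `σs ρ = 0` follows `σ ρ = σa ρ`, so the two tensor powers cancel.
  · rw [singular_iff_mul_eq_zero hs.isHermitian hρn, sub_mul, ← tensorPow_mul, ← tensorPow_mul,
      hd.eq_add, add_mul,
      (singular_iff_mul_eq_zero hd.posSemidef_sing.isHermitian hρ).1 hd.singular, add_zero,
      sub_self]

theorem IsLogLikelihoodRatio.absCont {σ ρ M : Matrix D D ℂ} (hρ : ρ.PosSemidef)
    (h : IsLogLikelihoodRatio σ ρ M) : AbsCont ρ σ := by
  obtain ⟨hM, σa, σs, hd, hσa⟩ := h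
  rw [hd.eq_add, hσa]
  exact absCont_conj_add (posDef_exp (isHermitian_half hM)) hρ hd.posSemidef_sing

open scoped MatrixOrder in
/-- `Tr ρ X X* = 0` forces `ρ X = 0`. -/
theorem mul_eq_zero_of_trace_mul_mul_conjTranspose_eq_zero {ρ X : Matrix D D ℂ}
    (hρ : ρ.PosSemidef) (h : (ρ * X * Xᴴ).trace = 0) : ρ * X = 0 := by
  obtain ⟨B, hB⟩ := CStarAlgebra.nonneg_iff_eq_star_mul_self.mp hρ.nonneg
  rw [Matrix.star_eq_conjTranspose] at hB
  have h1 : (ρ * X * Xᴴ).trace = (B * X * (B * X)ᴴ).trace := by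
    simp only [hB, Matrix.conjTranspose_mul, Matrix.mul_assoc]
    rw [Matrix.trace_mul_comm Bᴴ]
    simp only [Matrix.mul_assoc]
  rw [h1, Matrix.trace_mul_conjTranspose_self_eq_zero_iff] at h
  rw [hB, Matrix.mul_assoc, h, Matrix.mul_zero]

theorem trace_mul_mul_conjTranspose_nonneg {ρ : Matrix D D ℂ} (hρ : ρ.PosSemidef)
    (X : Matrix D D ℂ) : 0 ≤ (ρ * X * Xᴴ).trace := by
  rw [Matrix.mul_assoc, Matrix.trace_mul_comm, Matrix.mul_assoc, Matrix.trace_mul_comm]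
  exact (hρ.conjTranspose_mul_mul_same X).trace_nonneg

/-- If a Hermitian `K` anticommutes with `ρ ≥ 0` then `ρ K = 0`. -/
theorem mul_eq_zero_of_anticommute {ρ K : Matrix D D ℂ} (hρ : ρ.PosSemidef) (hK : K.IsHermitian)
    (h : ρ * K + K * ρ = 0) : ρ * K = 0 := by
  refine mul_eq_zero_of_trace_mul_mul_conjTranspose_eq_zero hρ ?_
  -- By cyclicity this trace is `2 Tr ρ K²`.
  have h1 : ((ρ * K + K * ρ) * K).trace = 0 := by rw [h, zero_mul, Matrix.trace_zero]
  have h2 : (K * ρ * K).trace = (ρ * K * K).trace := by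
    rw [Matrix.mul_assoc, Matrix.trace_mul_comm]
  rw [add_mul, Matrix.trace_add, h2] at h1
  rw [hK.eq]
  exact self_eq_neg.1 (eq_neg_of_add_eq_zero_left h1)

theorem trace_mul_mul_sum (ρ : Matrix D D ℂ) {d : ℕ} (A : Fin d → Matrix D D ℂ)
    (x y : Fin d → ℂ) :
    (ρ * (∑ i, x i • A i) * ∑ j, y j • A j).trace
      = ∑ i, ∑ j, x i * y j * covMatrix ρ A j i := by
  simp only [covMatrix, Matrix.of_apply, Finset.mul_sum, Finset.sum_mul, Matrix.trace_sum]
  rw [Finset.sum_comm]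
  refine Finset.sum_congr rfl fun i _ => Finset.sum_congr rfl fun j _ => ?_
  rw [Matrix.mul_smul, Matrix.mul_smul, Matrix.smul_mul, Matrix.trace_smul, Matrix.trace_smul]
  simp only [smul_eq_mul]
  ring

theorem conjTranspose_sum_smul {d : ℕ} {A : Fin d → Matrix D D ℂ} (hA : ∀ i, (A i).IsHermitian)
    (x : Fin d → ℂ) : (∑ i, x i • A i)ᴴ = ∑ i, star (x i) • A i := by
  rw [Matrix.conjTranspose_sum]
  exact Finset.sum_congr rfl fun i _ => by rw [Matrix.conjTranspose_smul, (hA i).eq]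

theorem posSemidef_covMatrix {ρ : Matrix D D ℂ} (hρ : ρ.PosSemidef) {d : ℕ}
    {A : Fin d → Matrix D D ℂ} (hA : ∀ i, (A i).IsHermitian) : (covMatrix ρ A).PosSemidef := by
  refine Matrix.PosSemidef.of_dotProduct_mulVec_nonneg ?_ fun x => ?_
  · ext i j
    rw [Matrix.conjTranspose_apply, covMatrix, Matrix.of_apply, Matrix.of_apply,
      ← Matrix.trace_conjTranspose, Matrix.conjTranspose_mul, Matrix.conjTranspose_mul,
      (hA i).eq, (hA j).eq, hρ.isHermitian.eq, ← Matrix.mul_assoc, Matrix.trace_mul_comm,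
      ← Matrix.mul_assoc]
  · have h := trace_mul_mul_conjTranspose_nonneg hρ (∑ i, x i • A i)
    rw [conjTranspose_sum_smul hA, trace_mul_mul_sum] at h
    convert h using 1
    simp only [dotProduct, Matrix.mulVec, Finset.mul_sum, Pi.star_apply]
    rw [Finset.sum_comm]
    exact Finset.sum_congr rfl fun i _ => Finset.sum_congr rfl fun j _ => by ring

theorem re_quadratic_covMatrix (ρ : Matrix D D ℂ) {d : ℕ} (A : Fin d → Matrix D D ℂ)
    (x : Fin d → ℝ) :
    star x ⬝ᵥ ((covMatrix ρ A).map Complex.re *ᵥ x)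
      = (ρ * (∑ i, (x i : ℂ) • A i) * ∑ i, (x i : ℂ) • A i).trace.re := by
  rw [trace_mul_mul_sum, Finset.sum_comm]
  simp only [dotProduct, Matrix.mulVec, Finset.mul_sum, Pi.star_apply, star_trivial,
    Complex.re_sum, Matrix.map_apply]
  refine Finset.sum_congr rfl fun i _ => Finset.sum_congr rfl fun j _ => ?_
  rw [← Complex.ofReal_mul, Complex.re_ofReal_mul]
  ring

/-- The real part of the covariance matrix is positive definite exactly if the symmetrized
products `(ρ Aᵢ + Aᵢ ρ) / 2` are linearly independent over `ℝ`. -/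
theorem posDef_re_covMatrix_iff {ρ : Matrix D D ℂ} (hρ : ρ.PosSemidef) {d : ℕ}
    {A : Fin d → Matrix D D ℂ} (hA : ∀ i, (A i).IsHermitian) :
    ((covMatrix ρ A).map Complex.re).PosDef ↔
      LinearIndependent ℝ fun i => (1 / 2 : ℂ) • (ρ * A i + A i * ρ) := by
  have hX : ∀ x : Fin d → ℝ, (∑ i, (x i : ℂ) • A i)ᴴ = ∑ i, (x i : ℂ) • A i := fun x => by
    rw [conjTranspose_sum_smul hA]; simp
  have hsum : ∀ x : Fin d → ℝ, (∑ i, x i • ((1 / 2 : ℂ) • (ρ * A i + A i * ρ)))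
      = (1 / 2 : ℂ) • (ρ * (∑ i, (x i : ℂ) • A i) + (∑ i, (x i : ℂ) • A i) * ρ) := by
    intro x
    rw [Finset.mul_sum, Finset.sum_mul, ← Finset.sum_add_distrib, Finset.smul_sum]
    refine Finset.sum_congr rfl fun i _ => ?_
    rw [Matrix.mul_smul, Matrix.smul_mul, ← smul_add, smul_comm, Complex.coe_smul]
  -- Both sides are equivalent to `ρ X = 0` for the Hermitian `X = ∑ xᵢ Aᵢ`.
  have hzero : ∀ x : Fin d → ℝ, (∑ i, x i • ((1 / 2 : ℂ) • (ρ * A i + A i * ρ))) = 0 ↔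
      star x ⬝ᵥ ((covMatrix ρ A).map Complex.re *ᵥ x) = 0 := by
    intro x
    rw [hsum, re_quadratic_covMatrix, smul_eq_zero_iff_right (by norm_num)]
    set X := ∑ i, (x i : ℂ) • A i with hXdef
    constructor
    · intro h
      rw [mul_eq_zero_of_anticommute hρ (hX x) h, zero_mul, Matrix.trace_zero, Complex.zero_re]
    · intro h
      have hnn := trace_mul_mul_conjTranspose_nonneg hρ X
      have h0 : ρ * X = 0 := by
        refine mul_eq_zero_of_trace_mul_mul_conjTranspose_eq_zero hρ ?_
        refine Complex.ext ?_ (Complex.nonneg_iff.1 hnn).2.symm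
        rw [hX x]
        exact h
      have h1 := congrArg Matrix.conjTranspose h0
      rw [Matrix.conjTranspose_mul, hX x, hρ.isHermitian.eq, Matrix.conjTranspose_zero] at h1
      rw [h0, h1, add_zero]
  have hnonneg : ∀ x : Fin d → ℝ, 0 ≤ star x ⬝ᵥ ((covMatrix ρ A).map Complex.re *ᵥ x) := by
    intro x
    rw [re_quadratic_covMatrix]
    have hnn := trace_mul_mul_conjTranspose_nonneg hρ (∑ i, (x i : ℂ) • A i)
    rw [hX x] at hnn
    exact (Complex.nonneg_iff.1 hnn).1
  rw [Fintype.linearIndependent_iff]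
  constructor
  · intro h x hx i
    by_contra hi
    have hx0 : x ≠ 0 := fun h0 => hi (congrFun h0 i)
    exact (h.dotProduct_mulVec_pos hx0).ne' ((hzero x).1 hx)
  · intro h
    refine Matrix.PosDef.of_dotProduct_mulVec_pos ?_ fun x hx =>
      lt_of_le_of_ne (hnonneg x) fun h0 => hx (funext (h x ((hzero x).2 h0.symm)))
    ext i j
    have := congrFun (congrFun (posSemidef_covMatrix hρ hA).isHermitian i) j
    rw [Matrix.conjTranspose_apply] at this ⊢
    simp only [Matrix.map_apply, star_trivial]
    rw [← this]
    simp

end Operators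

/-! ### Second order expansion of products of exponentials -/

section Expansion

open Filter Asymptotics

variable {𝔸 : Type*} [NormedRing 𝔸] [NormedAlgebra ℂ 𝔸] [CompleteSpace 𝔸]
  {ι : Type*} {l : Filter ι} {s : ι → ℝ}

theorem exp_sub_quadratic_isBigO :
    (fun y : 𝔸 => NormedSpace.exp y - (1 + y + (1 / 2 : ℂ) • (y * y))) =O[𝓝 0]
      fun y => ‖y‖ ^ 3 := by
  have h := (NormedSpace.exp_hasFPowerSeriesAt_zero (𝕂 := ℂ) (𝔸 := 𝔸)).isBigO_sub_partialSum_pow 3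
  refine h.congr_left fun y => ?_
  simp only [zero_add, FormalMultilinearSeries.partialSum, Finset.sum_range_succ,
    Finset.sum_range_zero, NormedSpace.expSeries_apply_eq]
  simp [pow_two, Nat.factorial]

theorem exp_comp_sub_quadratic_isLittleO (hs : Tendsto s l (𝓝 0)) {Y : ι → 𝔸} (hY : Y =O[l] s) :
    (fun i => NormedSpace.exp (Y i) - (1 + Y i + (1 / 2 : ℂ) • (Y i * Y i))) =o[l]
      fun i => s i ^ 2 := by
  have h1 := (exp_sub_quadratic_isBigO (𝔸 := 𝔸)).comp_tendsto (hY.trans_tendsto hs)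
  have h2 : (fun i => ‖Y i‖ ^ 3) =O[l] fun i => s i ^ 3 := hY.norm_left.pow 3
  exact (h1.trans h2).trans_isLittleO ((isLittleO_pow_pow (𝕜 := ℝ) (by norm_num)).comp_tendsto hs)

/-- The second order term of the expansion of `∏ₜ exp (Yₜ)`. -/
def quadraticTerm {R : Type*} [Ring R] [Module ℂ R] {r : ℕ} (Y : Fin r → R) : R :=
  ∑ t, (1 / 2 : ℂ) • (Y t * Y t) + ∑ t, ∑ u ∈ Finset.Ioi t, Y t * Y u

theorem quadraticTerm_succ {r : ℕ} (Y : Fin (r + 1) → 𝔸) :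
    quadraticTerm Y = (1 / 2 : ℂ) • (Y 0 * Y 0) + Y 0 * ∑ t : Fin r, Y t.succ
      + quadraticTerm fun t => Y t.succ := by
  simp only [quadraticTerm, Fin.sum_univ_succ, Fin.sum_Ioi_zero, Fin.sum_Ioi_succ, Finset.mul_sum]
  abel

theorem quadraticTerm_isBigO {r : ℕ} {Y : Fin r → ι → 𝔸} (hY : ∀ t, Y t =O[l] s) :
    (fun i => quadraticTerm fun t => Y t i) =O[l] fun i => s i ^ 2 := by
  have h : ∀ t u, (fun i => Y t i * Y u i) =O[l] fun i => s i ^ 2 := fun t u => by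
    simpa only [pow_two] using (hY t).mul (hY u)
  have h' : ∀ t, (fun i => (1 / 2 : ℂ) • (Y t i * Y t i)) =O[l] fun i => s i ^ 2 := fun t =>
    (h t t).const_smul_left (1 / 2 : ℂ)
  exact (IsBigO.fun_sum fun t _ => h' t).add
    (IsBigO.fun_sum fun t _ => IsBigO.fun_sum fun u _ => h t u)

/-- Induction peels off the first factor on the left; the order of factors is retained in the cross
terms with `t < u`. -/
theorem prod_exp_sub_quadratic_isLittleO (hs : Tendsto s l (𝓝 0)) {r : ℕ} {Y : Fin r → ι → 𝔸}
    (hY : ∀ t, Y t =O[l] s) :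
    (fun i => (List.ofFn fun t => NormedSpace.exp (Y t i)).prod
      - (1 + ∑ t, Y t i + quadraticTerm fun t => Y t i)) =o[l] fun i => s i ^ 2 := by
  induction r with
  | zero => simp [quadraticTerm]
  | succ r ih =>
    have hs1 : s =O[l] fun _ => (1 : ℝ) := hs.isBigO_one ℝ
    have hs2 : (fun i => s i ^ 2) =O[l] fun _ => (1 : ℝ) := by simpa using hs1.pow 2
    have hs3 : (fun i => s i ^ 2 * s i) =o[l] fun i => s i ^ 2 := by
      simp only [← pow_succ]
      exact (isLittleO_pow_pow (𝕜 := ℝ) (show 2 < 3 by norm_num)).comp_tendsto hs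
    have hY' : ∀ t : Fin r, Y t.succ =O[l] s := fun t => hY t.succ
    have hf := ih hY'
    have he := exp_comp_sub_quadratic_isLittleO hs (hY 0)
    have hS : (fun i => ∑ t : Fin r, Y t.succ i) =O[l] s := IsBigO.fun_sum fun t _ => hY' t
    have hQ := quadraticTerm_isBigO hY'
    have hY0 : (fun i => (1 / 2 : ℂ) • (Y 0 i * Y 0 i)) =O[l] fun i => s i ^ 2 := by
      simp only [pow_two]
      exact ((hY 0).mul (hY 0)).const_smul_left (1 / 2 : ℂ)
    have h1 : (fun _ : ι => (1 : 𝔸)) =O[l] fun _ => (1 : ℝ) := isBigO_const_const _ one_ne_zero _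
    have hP : (fun i => (List.ofFn fun t : Fin r => NormedSpace.exp (Y t.succ i)).prod) =O[l]
        fun _ => (1 : ℝ) := by
      refine ((hf.isBigO.trans hs2).add
        ((h1.add (hS.trans hs1)).add (hQ.trans hs2))).congr_left fun i => ?_
      abel
    have hE : (fun i => 1 + Y 0 i + (1 / 2 : ℂ) • (Y 0 i * Y 0 i)) =O[l] fun _ => (1 : ℝ) :=
      (h1.add ((hY 0).trans hs1)).add (hY0.trans hs2)
    have e1 := he.mul_isBigO hP
    have e2 := hE.mul_isLittleO hf
    have e3 := (hY 0).mul hQ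
    have e4 := hY0.mul (hS.add (hQ.trans ((isBigO_refl s l).mul hs1 |>.congr
      (fun i => (pow_two (s i)).symm) fun i => mul_one _)))
    simp only [mul_one, one_mul] at e1 e2
    have e3' := (e3.congr_right fun i => mul_comm _ _).trans_isLittleO hs3
    have e4' := e4.trans_isLittleO hs3
    refine (((e1.add e2).add e3').add e4').congr_left fun i => ?_
    rw [quadraticTerm_succ, List.ofFn_succ, List.prod_cons, Fin.sum_univ_succ]
    noncomm_ring

/-- An `o(s)` approximation `s Z` of `Y` determines the quadratic terms up to `o(s²)` but not the
linear ones, so `φ (Y t)` needs its own bound `hYφ`. -/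
theorem map_prod_exp_sub_isLittleO (hs : Tendsto s l (𝓝 0)) (φ : 𝔸 →L[ℂ] ℂ) (hφ : φ 1 = 1)
    {r : ℕ} {Y : Fin r → ι → 𝔸} {Z : Fin r → 𝔸}
    (hYZ : ∀ t, (fun i => Y t i - (s i : ℂ) • Z t) =o[l] s)
    (hYφ : ∀ t, (fun i => φ (Y t i)) =o[l] fun i => s i ^ 2) :
    (fun i => φ (List.ofFn fun t => NormedSpace.exp (Y t i)).prod
      - (1 + (s i : ℂ) ^ 2 * φ (quadraticTerm Z))) =o[l] fun i => s i ^ 2 := by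
  have hZ : ∀ t, (fun i => (s i : ℂ) • Z t) =O[l] s := fun t =>
    IsBigO.of_bound ‖Z t‖ (Eventually.of_forall fun i => by
      rw [norm_smul, Complex.norm_real, mul_comm])
  have hY : ∀ t, Y t =O[l] s := fun t =>
    ((hYZ t).isBigO.add (hZ t)).congr_left fun i => by abel
  have h1 : ∀ t u, (fun i => Y t i * Y u i - ((s i : ℂ) • Z t) * ((s i : ℂ) • Z u)) =o[l]
      fun i => s i ^ 2 := fun t u => by
    refine (((hYZ t).mul_isBigO (hY u)).add ((hZ t).mul_isLittleO (hYZ u))).congr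
      (fun i => ?_) fun i => (pow_two _).symm
    noncomm_ring
  have h2 : (fun i => (quadraticTerm fun t => Y t i) - (s i : ℂ) ^ 2 • quadraticTerm Z) =o[l]
      fun i => s i ^ 2 := by
    have h1' : ∀ t, (fun i => (1 / 2 : ℂ) •
        (Y t i * Y t i - ((s i : ℂ) • Z t) * ((s i : ℂ) • Z t))) =o[l] fun i => s i ^ 2 :=
      fun t => (h1 t t).const_smul_left (1 / 2 : ℂ)
    refine ((IsLittleO.fun_sum fun t (_ : t ∈ Finset.univ) => h1' t).add
      (IsLittleO.fun_sum fun t (_ : t ∈ Finset.univ) => IsLittleO.fun_sum fun u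
        (_ : u ∈ Finset.Ioi t) => h1 t u)).congr_left fun i => ?_
    simp only [quadraticTerm, smul_add, Finset.smul_sum, Finset.sum_sub_distrib, smul_sub,
      smul_mul_smul_comm, pow_two, smul_smul, mul_comm (1 / 2 : ℂ)]
    abel
  have h3 := (φ.isBigO_comp _ l).trans_isLittleO (prod_exp_sub_quadratic_isLittleO hs hY)
  have h4 := (φ.isBigO_comp _ l).trans_isLittleO h2
  have h5 := IsLittleO.fun_sum fun t (_ : t ∈ Finset.univ) => hYφ t
  refine ((h3.add h4).add h5).congr_left fun i => ?_
  simp only [map_sub, map_add, map_sum, hφ, map_smul, smul_eq_mul]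
  ring

end Expansion

/-! ### The limit of the `n`th powers -/

section Limit

open Filter Asymptotics

variable {𝔸 : Type*} [NormedRing 𝔸] [NormedAlgebra ℂ 𝔸] [CompleteSpace 𝔸]

theorem tendsto_inv_sqrt_natCast :
    Tendsto (fun n : ℕ => (Real.sqrt n)⁻¹) atTop (𝓝 0) :=
  tendsto_inv_atTop_zero.comp (Real.tendsto_sqrt_atTop.comp tendsto_natCast_atTop_atTop)

theorem tendsto_map_prod_exp_pow (φ : 𝔸 →L[ℂ] ℂ) (hφ : φ 1 = 1)
    {r : ℕ} {Y : Fin r → ℕ → 𝔸} {Z : Fin r → 𝔸}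
    (hYZ : ∀ t, (fun n => Y t n - (((Real.sqrt n)⁻¹ : ℝ) : ℂ) • Z t) =o[atTop]
      fun n : ℕ => (Real.sqrt n)⁻¹)
    (hYφ : ∀ t, (fun n => φ (Y t n)) =o[atTop] fun n : ℕ => (Real.sqrt n)⁻¹ ^ 2) :
    Tendsto (fun n : ℕ => φ (List.ofFn fun t => NormedSpace.exp (Y t n)).prod ^ n) atTop
      (𝓝 (Complex.exp (φ (quadraticTerm Z)))) := by
  have h := map_prod_exp_sub_isLittleO tendsto_inv_sqrt_natCast φ hφ hYZ hYφ
  have hsq : ∀ n : ℕ, (Real.sqrt n)⁻¹ ^ 2 = (n : ℝ)⁻¹ := fun n => by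
    rw [inv_pow, Real.sq_sqrt (Nat.cast_nonneg n)]
  have h1 : Tendsto (fun n : ℕ => (n : ℂ) *
      (φ (List.ofFn fun t => NormedSpace.exp (Y t n)).prod - 1)) atTop
      (𝓝 (φ (quadraticTerm Z))) := by
    have h2 : (fun n : ℕ => φ (List.ofFn fun t => NormedSpace.exp (Y t n)).prod
        - (1 + (((Real.sqrt n)⁻¹ : ℝ) : ℂ) ^ 2 * φ (quadraticTerm Z))) =o[atTop]
        fun n : ℕ => (n : ℂ)⁻¹ := by
      -- This includes `n = 0`, where both inverses are `0`.
      refine h.trans_isBigO (IsBigO.of_bound 1 (Eventually.of_forall fun n => ?_))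
      simp [Real.sq_sqrt]
    have h3 := h2.tendsto_div_nhds_zero
    have h4 := h3.add_const (φ (quadraticTerm Z))
    rw [zero_add] at h4
    refine h4.congr' ?_
    filter_upwards [eventually_gt_atTop 0] with n hn
    have hn' : (n : ℂ) ≠ 0 := by exact_mod_cast hn.ne'
    rw [← Complex.ofReal_pow, hsq]
    push_cast
    field_simp
    ring
  refine (Complex.tendsto_one_add_pow_exp_of_tendsto h1).congr fun n => ?_
  rw [add_sub_cancel]

end Limit

/-! ### The central limit theorem and consequences of the trace condition -/

section Model

open Filter Asymptotics

open scoped Matrix.Norms.Operator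

variable {D : Type*} [Fintype D] [DecidableEq D] {d : ℕ}

/-- The expectation functional `M ↦ Tr ρ M`. -/
def expectation (ρ : Matrix D D ℂ) : Matrix D D ℂ →L[ℂ] ℂ :=
  LinearMap.toContinuousLinearMap
    ((Matrix.traceLinearMap D ℂ ℂ).comp (LinearMap.mulLeft ℂ ρ))

theorem trace_mul_isBigO (ρ : Matrix D D ℂ) {α : Type*} (f : α → Matrix D D ℂ) (l : Filter α) :
    (fun x => (ρ * f x).trace) =O[l] f :=
  (expectation ρ).isBigO_comp f l

theorem tendsto_trace_prod_exp_pow {ρ : Matrix D D ℂ} (hρ : ρ.trace = 1)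
    {r : ℕ} {Y : Fin r → ℕ → Matrix D D ℂ} {Z : Fin r → Matrix D D ℂ}
    (hYZ : ∀ t, (fun n => Y t n - (((Real.sqrt n)⁻¹ : ℝ) : ℂ) • Z t) =o[atTop]
      fun n : ℕ => (Real.sqrt n)⁻¹)
    (hYρ : ∀ t, (fun n => (ρ * Y t n).trace) =o[atTop] fun n : ℕ => (Real.sqrt n)⁻¹ ^ 2) :
    Tendsto (fun n : ℕ => (ρ * (List.ofFn fun t => NormedSpace.exp (Y t n)).prod).trace ^ n) atTop
      (𝓝 (Complex.exp (ρ * quadraticTerm Z).trace)) :=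
  tendsto_map_prod_exp_pow (expectation ρ)
    ((congrArg Matrix.trace (mul_one ρ)).trans hρ) hYZ hYρ

theorem trace_mul_quadraticTerm_eq (ρ : Matrix D D ℂ) {r : ℕ} (X : Fin r → Matrix D D ℂ) :
    (ρ * quadraticTerm X).trace = ∑ t, (1 / 2) * (ρ * (X t * X t)).trace
      + ∑ t, ∑ u ∈ Finset.Ioi t, (ρ * (X t * X u)).trace := by
  simp only [quadraticTerm, Matrix.mul_add, Matrix.mul_sum, Matrix.trace_add, Matrix.trace_sum,
    Matrix.mul_smul, Matrix.trace_smul, smul_eq_mul]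

/-- In a product of two factors, `W` on the left is killed by `ρ W = 0`, and `W` on the right by
cyclicity and `W ρ = 0`. Hence no `η` survives. -/
theorem trace_mul_quadraticTerm (ρ : Matrix D D ℂ) {A : Fin d → Matrix D D ℂ}
    {W : Matrix D D ℂ} (hρW : ρ * W = 0) (hWρ : W * ρ = 0) {r : ℕ} (ξ : Fin r → Fin d → ℂ)
    (η : Fin r → ℂ) :
    (ρ * quadraticTerm fun t => Complex.I • (∑ i, ξ t i • A i + η t • W)).trace
      = (∑ t, -((1 / 2) * ∑ i, ∑ j, ξ t i * ξ t j * covMatrix ρ A j i))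
        - ∑ t, ∑ u ∈ Finset.Ioi t, ∑ i, ∑ j, ξ t i * ξ u j * covMatrix ρ A j i := by
  have h : ∀ t u, (ρ * ((Complex.I • (∑ i, ξ t i • A i + η t • W))
      * (Complex.I • (∑ i, ξ u i • A i + η u • W)))).trace
      = -∑ i, ∑ j, ξ t i * ξ u j * covMatrix ρ A j i := by
    intro t u
    rw [← trace_mul_mul_sum, smul_mul_smul_comm, Complex.I_mul_I, neg_one_smul, Matrix.mul_neg,
      Matrix.trace_neg, ← Matrix.mul_assoc, Matrix.mul_add ρ, Matrix.mul_smul, hρW, smul_zero,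
      add_zero, Matrix.mul_add, Matrix.trace_add, Matrix.mul_smul,
      Matrix.trace_smul _ (ρ * _ * W), Matrix.trace_mul_comm _ W, ← Matrix.mul_assoc W, hWρ,
      zero_mul, Matrix.trace_zero, smul_zero, add_zero]
  rw [trace_mul_quadraticTerm_eq]
  simp only [h, Finset.sum_neg_distrib, mul_neg, sub_eq_add_neg]

/-- The central limit theorem for sums of i.i.d. observables, with an additional sum of
observables `V n` that are negligible at the central limit scale. -/
theorem isInfinitesimal_siteSum {ρ : Matrix D D ℂ} (hρ : ρ.trace = 1)
    {A : Fin d → Matrix D D ℂ} (hA : ∀ i, (ρ * A i).trace = 0)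
    {W : Matrix D D ℂ} (hρW : ρ * W = 0) (hWρ : W * ρ = 0) {V : ℕ → Matrix D D ℂ}
    (hVW : (fun n => V n - (((Real.sqrt n)⁻¹ : ℝ) : ℂ) • W) =o[atTop]
      fun n : ℕ => (Real.sqrt n)⁻¹)
    (hV : (fun n => (ρ * V n).trace) =o[atTop] fun n : ℕ => (Real.sqrt n)⁻¹ ^ 2) :
    IsInfinitesimal (D := fun n => Fin n → D) (fun n i => normalizedSum n (A i))
      (fun n => tensorPow n ρ) (covMatrix ρ A) fun n => siteSum n (V n) := by
  intro r ξ η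
  -- The one-site operator whose site sum is the whole exponent, with the normalization moved
  -- inside.
  set Y : Fin r → ℕ → Matrix D D ℂ := fun t n =>
    Complex.I • ((((Real.sqrt n)⁻¹ : ℝ) : ℂ) • (∑ i, ξ t i • A i) + η t • V n) with hYdef
  have hexp : ∀ (n : ℕ) (t : Fin r),
      Complex.I • (∑ i, ξ t i • normalizedSum n (A i) + η t • siteSum n (V n))
        = siteSum n (Y t n) := by
    intro n t
    have h : siteSum n (Y t n) = siteSumLinear n (Y t n) := (siteSumLinear_apply n _).symm
    rw [h, hYdef]
    simp only [map_smul, map_add, map_sum, siteSumLinear_apply, normalizedSum, Finset.smul_sum]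
    congr 2
    exact Finset.sum_congr rfl fun i _ => smul_comm _ _ _
  have hlim := tendsto_trace_prod_exp_pow hρ (Y := Y)
    (Z := fun t => Complex.I • (∑ i, ξ t i • A i + η t • W)) (fun t => ?_) fun t => ?_
  · rw [trace_mul_quadraticTerm ρ hρW hWρ] at hlim
    have hg : gaussianQuasiChar 0 (covMatrix ρ A) ξ
        = Complex.exp ((∑ t, -((1 / 2) * ∑ i, ∑ j, ξ t i * ξ t j * covMatrix ρ A j i))
        - ∑ t, ∑ u ∈ Finset.Ioi t, ∑ i, ∑ j, ξ t i * ξ u j * covMatrix ρ A j i) := by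
      simp [gaussianQuasiChar]
    rw [hg]
    refine hlim.congr fun n => ?_
    simp only [hexp]
    rw [prod_exp_siteSum, ← tensorPow_mul, trace_tensorPow]
  · have h := hVW.const_smul_left (Complex.I * η t)
    refine h.congr_left fun n => ?_
    simp only [hYdef, Pi.smul_apply]
    module
  · have h := hV.const_mul_left (Complex.I * η t)
    refine h.congr_left fun n => ?_
    simp only [hYdef, Matrix.mul_smul, Matrix.mul_add, Matrix.mul_sum, Matrix.trace_smul,
      Matrix.trace_add, Matrix.trace_sum, hA, Finset.sum_const_zero, zero_add,
      smul_eq_mul, mul_assoc, mul_zero]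

/-- The adjoint is real linear, so it commutes with the real derivative. -/
theorem isHermitian_fderiv {L : Param d → Matrix D D ℂ} (hdiff : DifferentiableAt ℝ L 0)
    (hL : ∀ᶠ h in 𝓝 0, (L h).IsHermitian) (v : Param d) : (fderiv ℝ L 0 v).IsHermitian := by
  have h1 : HasFDerivAt (fun h => (L h)ᴴ)
      ((LinearMap.toContinuousLinearMap
        (Matrix.conjTransposeLinearEquiv D D ℝ ℂ).toLinearMap).comp (fderiv ℝ L 0)) 0 :=
    (LinearMap.toContinuousLinearMap
      (Matrix.conjTransposeLinearEquiv D D ℝ ℂ).toLinearMap).hasFDerivAt.comp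
        (0 : Param d) hdiff.hasFDerivAt
  have h2 := hdiff.hasFDerivAt.congr_of_eventuallyEq (hL.mono fun h hh => hh.eq)
  exact DFunLike.congr_fun (h1.unique h2) v

variable {ρ : Matrix D D ℂ} {L : Param d → Matrix D D ℂ}

/-- Differentiability suffices to replace `L h` by its derivative in the quadratic term of `exp`.
The linear term `Tr ρ (L h)` is not expanded: the trace condition determines it to second order. -/
theorem trace_mul_logLikelihood_isLittleO (hρ : ρ.trace = 1) (hL0 : L 0 = 0)
    (hdiff : DifferentiableAt ℝ L 0)
    (htrace : (fun h => (ρ * NormedSpace.exp (L h)).trace - 1)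
      =o[𝓝 (0 : Param d)] fun h => ‖h‖ ^ 2) :
    (fun h => (ρ * L h).trace + (1 / 2) * (ρ * (fderiv ℝ L 0 h * fderiv ℝ L 0 h)).trace)
      =o[𝓝 (0 : Param d)] fun h => ‖h‖ ^ 2 := by
  have hs : Tendsto (fun h : Param d => ‖h‖) (𝓝 0) (𝓝 0) := tendsto_norm_zero
  have h1 : (fun h => L h - fderiv ℝ L 0 h) =o[𝓝 (0 : Param d)] fun h => ‖h‖ := by
    refine hdiff.hasFDerivAt.isLittleO.norm_right.congr (fun h => ?_) fun h => ?_
    · rw [hL0, sub_zero, sub_zero]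
      rfl
    · rw [sub_zero]
  have h2 : (fun h => fderiv ℝ L 0 h) =O[𝓝 (0 : Param d)] fun h => ‖h‖ :=
    ((fderiv ℝ L 0).isBigO_id _).norm_right
  have h3 : L =O[𝓝 (0 : Param d)] fun h => ‖h‖ :=
    (h1.isBigO.add h2).congr_left fun h => by abel
  have h4 : (fun h => L h * L h - fderiv ℝ L 0 h * fderiv ℝ L 0 h) =o[𝓝 (0 : Param d)]
      fun h => ‖h‖ ^ 2 := by
    refine ((h1.mul_isBigO h3).add (h2.mul_isLittleO h1)).congr (fun h => ?_)
      fun h => (pow_two _).symm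
    noncomm_ring
  have h5 : (fun h => (ρ * (NormedSpace.exp (L h)
      - (1 + L h + (1 / 2 : ℂ) • (L h * L h)))).trace) =o[𝓝 (0 : Param d)] fun h => ‖h‖ ^ 2 :=
    (trace_mul_isBigO ρ _ _).trans_isLittleO
    (exp_comp_sub_quadratic_isLittleO hs h3)
  have h6 := (trace_mul_isBigO ρ _ _).trans_isLittleO h4
  refine ((htrace.sub h5).sub (h6.const_mul_left (1 / 2))).congr_left fun h => ?_
  simp only [Matrix.mul_sub, Matrix.mul_add, Matrix.trace_sub,
    Matrix.trace_add, Matrix.mul_one, Matrix.mul_smul, Matrix.trace_smul, smul_eq_mul, hρ]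
  ring

/-- By the preceding expansion `Tr ρ (L h) = O(‖h‖²)`, so its derivative at `0` vanishes. -/
theorem trace_mul_fderiv_eq_zero (hρ : ρ.trace = 1) (hL0 : L 0 = 0)
    (hdiff : DifferentiableAt ℝ L 0)
    (htrace : (fun h => (ρ * NormedSpace.exp (L h)).trace - 1)
      =o[𝓝 (0 : Param d)] fun h => ‖h‖ ^ 2) (v : Param d) :
    (ρ * fderiv ℝ L 0 v).trace = 0 := by
  have h1 := (trace_mul_logLikelihood_isLittleO hρ hL0 hdiff htrace).isBigO
  have h2 : (fun h => fderiv ℝ L 0 h) =O[𝓝 (0 : Param d)] fun h => ‖h‖ :=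
    ((fderiv ℝ L 0).isBigO_id _).norm_right
  have h3 : (fun h => (ρ * (fderiv ℝ L 0 h * fderiv ℝ L 0 h)).trace) =O[𝓝 (0 : Param d)]
      fun h => ‖h‖ ^ 2 :=
    ((trace_mul_isBigO ρ _ _).trans (h2.mul h2)).congr_right fun h => (pow_two _).symm
  have h4 : (fun h => expectation ρ (L h)) =O[𝓝 (0 : Param d)] fun h => ‖h - 0‖ ^ 2 := by
    refine (h1.sub (h3.const_mul_left (1 / 2))).congr (fun h => ?_) fun h => by rw [sub_zero]
    rw [add_sub_cancel_right]
    rfl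
  have h5 := h4.hasFDerivAt (𝕜 := ℝ) one_lt_two
  have h6 := ((expectation ρ).restrictScalars ℝ).hasFDerivAt.comp (0 : Param d) hdiff.hasFDerivAt
  exact (DFunLike.congr_fun (h5.unique h6) v).symm

open scoped MatrixOrder in
/-- The entries of a positive matrix are bounded by its trace. -/
theorem norm_entry_le_trace {M : Matrix D D ℂ} (hM : M.PosSemidef) (i j : D) :
    ‖M i j‖ ≤ M.trace.re := by
  obtain ⟨B, rfl⟩ := CStarAlgebra.nonneg_iff_eq_star_mul_self.mp hM.nonneg
  rw [Matrix.star_eq_conjTranspose] at hM ⊢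
  have hdiag : ∀ k, ((Bᴴ * B) k k).re = ∑ l, ‖B l k‖ ^ 2 := fun k => by
    simp only [Matrix.mul_apply, Matrix.conjTranspose_apply, Complex.re_sum]
    refine Finset.sum_congr rfl fun l _ => ?_
    rw [Complex.star_def, Complex.conj_mul', ← Complex.ofReal_pow, Complex.ofReal_re]
  have htr : ∀ k, ∑ l, ‖B l k‖ ^ 2 ≤ (Bᴴ * B).trace.re := fun k => by
    simp only [Matrix.trace, Matrix.diag, Complex.re_sum, hdiag]
    exact Finset.single_le_sum (f := fun k => ∑ l, ‖B l k‖ ^ 2)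
      (fun _ _ => by positivity) (Finset.mem_univ k)
  -- The arithmetic-geometric mean inequality bounds the entry by the mean of two diagonal entries.
  have h : ‖(Bᴴ * B) i j‖ ≤ ∑ l, (‖B l i‖ ^ 2 + ‖B l j‖ ^ 2) / 2 := by
    rw [Matrix.mul_apply]
    refine (norm_sum_le _ _).trans (Finset.sum_le_sum fun l _ => ?_)
    rw [norm_mul, Matrix.conjTranspose_apply, norm_star]
    nlinarith [sq_nonneg (‖B l i‖ - ‖B l j‖)]
  rw [← Finset.sum_div, Finset.sum_add_distrib] at h
  linarith [htr i, htr j]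

theorem isLittleO_of_entries {α : Type*} {l : Filter α} {g : α → ℝ} {M : α → Matrix D D ℂ}
    (h : ∀ i j, (fun x => M x i j) =o[l] g) : M =o[l] g := by
  have h1 : ∀ i j, (fun x => Matrix.single i j (M x i j)) =o[l] g := fun i j => by
    have := ((LinearMap.toContinuousLinearMap
      (Matrix.singleLinearMap ℂ i j : ℂ →ₗ[ℂ] Matrix D D ℂ)).isBigO_comp
        (fun x => M x i j) l).trans_isLittleO (h i j)
    exact this
  refine (IsLittleO.fun_sum fun i (_ : i ∈ Finset.univ) =>
    IsLittleO.fun_sum fun j (_ : j ∈ Finset.univ) => h1 i j).congr_left fun x => ?_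
  exact (Matrix.matrix_eq_sum_single (M x)).symm

end Model

/-! ### SLDs and the expansion of the log-likelihood ratio -/

section Model

open Filter Asymptotics

open scoped Matrix.Norms.Operator

variable {D : Type*} [Fintype D] [DecidableEq D] {d : ℕ}

/-- The singular part of the Lebesgue decomposition is bounded entrywise by the missing mass. -/
theorem IsLogLikelihoodRatio.norm_sub_apply_le {σ ρ M : Matrix D D ℂ} (hσ : σ.trace = 1)
    (h : IsLogLikelihoodRatio σ ρ M) (i j : D) :
    ‖(σ - NormedSpace.exp ((1 / 2 : ℂ) • M) * ρ * NormedSpace.exp ((1 / 2 : ℂ) • M)) i j‖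
      ≤ ‖(ρ * NormedSpace.exp M).trace - 1‖ := by
  obtain ⟨hM, σa, σs, hd, hσa⟩ := h
  have hs : σ - NormedSpace.exp ((1 / 2 : ℂ) • M) * ρ * NormedSpace.exp ((1 / 2 : ℂ) • M)
      = σs := by
    rw [← hσa, hd.eq_add, add_sub_cancel_left]
  have ht : σs.trace = -((ρ * NormedSpace.exp M).trace - 1) := by
    rw [← hs, Matrix.trace_sub, hσ, Matrix.mul_assoc, Matrix.trace_mul_comm, Matrix.mul_assoc,
      exp_half_mul_exp_half]
    ring
  rw [hs]
  refine (norm_entry_le_trace hd.posSemidef_sing i j).trans ?_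
  rw [← norm_neg, ← ht]
  exact Complex.re_le_norm _

/-- The derivative of the log-likelihood ratio is a symmetric logarithmic derivative. -/
theorem isSLD_fderiv {Θ : Set (Param d)} (hΘ : IsOpen Θ) {θ₀ : Param d} (hθ₀ : θ₀ ∈ Θ)
    {ρ : Param d → Matrix D D ℂ} (hρ : ∀ θ ∈ Θ, IsDensity (ρ θ))
    {L : Param d → Matrix D D ℂ}
    (hL : ∀ h, θ₀ + h ∈ Θ → IsLogLikelihoodRatio (ρ (θ₀ + h)) (ρ θ₀) (L h))
    (hL0 : L 0 = 0) (hdiff : DifferentiableAt ℝ L 0)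
    (htrace : (fun h => (ρ θ₀ * NormedSpace.exp (L h)).trace - 1)
      =o[𝓝 (0 : Param d)] fun h => ‖h‖ ^ 2) (i : Fin d) :
    IsSLD ρ θ₀ i (fderiv ℝ L 0 (EuclideanSpace.single i (1 : ℝ))) := by
  have hmem : ∀ᶠ h in 𝓝 (0 : Param d), θ₀ + h ∈ Θ := by
    have hc : Tendsto (fun h : Param d => θ₀ + h) (𝓝 0) (𝓝 θ₀) := by
      simpa using (continuous_const_add θ₀).tendsto (0 : Param d)
    exact hc.eventually (hΘ.mem_nhds hθ₀)
  refine ⟨isHermitian_fderiv hdiff (hmem.mono fun h hh => (hL h hh).1) _, ?_⟩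
  set e : Param d := EuclideanSpace.single i (1 : ℝ) with he
  have hc : HasDerivAt (fun t : ℝ => t • e) e 0 := by
    simpa using (hasDerivAt_id (0 : ℝ)).smul_const e
  have hc0 : Tendsto (fun t : ℝ => t • e) (𝓝 0) (𝓝 0) := by
    simpa using hc.continuousAt.tendsto
  have hLt : HasDerivAt (fun t : ℝ => (1 / 2 : ℂ) • L (t • e)) ((1 / 2 : ℂ) • fderiv ℝ L 0 e) 0 :=
    (HasFDerivAt.comp_hasDerivAt_of_eq (0 : ℝ) hdiff.hasFDerivAt hc
      (zero_smul ℝ e).symm).const_smul (1 / 2 : ℂ)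
  -- Since `L 0 = 0`, `exp` is differentiated at `0`, where its derivative is the identity; no
  -- commutation is needed.
  have hE : HasDerivAt (fun t : ℝ => NormedSpace.exp ((1 / 2 : ℂ) • L (t • e)))
      ((1 / 2 : ℂ) • fderiv ℝ L 0 e) 0 :=
    HasFDerivAt.comp_hasDerivAt_of_eq (0 : ℝ)
      (hasFDerivAt_exp_zero (𝕂 := ℝ) (𝔸 := Matrix D D ℂ)) hLt (by rw [zero_smul, hL0, smul_zero])
  have hEρE := (hE.mul_const (ρ θ₀)).mul hE
  -- The singular part is `o(t²)` entrywise, being dominated by the trace defect.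
  have hsing : HasDerivAt (fun t : ℝ => coordCurve ρ θ₀ i t
      - NormedSpace.exp ((1 / 2 : ℂ) • L (t • e)) * ρ θ₀
        * NormedSpace.exp ((1 / 2 : ℂ) • L (t • e))) 0 0 := by
    have ho : (fun t : ℝ => coordCurve ρ θ₀ i t
      - NormedSpace.exp ((1 / 2 : ℂ) • L (t • e)) * ρ θ₀
        * NormedSpace.exp ((1 / 2 : ℂ) • L (t • e))) =o[𝓝 0] fun t : ℝ => ‖t - 0‖ ^ 2 := by
      refine isLittleO_of_entries fun a b => ?_
      have h1 : (fun t : ℝ => (ρ θ₀ * NormedSpace.exp (L (t • e))).trace - 1) =o[𝓝 0]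
          fun t : ℝ => ‖t - 0‖ ^ 2 := by
        refine (htrace.comp_tendsto hc0).congr_right fun t => ?_
        simp [he, norm_smul]
      refine IsBigO.trans_isLittleO (IsBigO.of_bound 1 ?_) h1
      filter_upwards [hc0.eventually hmem] with t ht
      rw [one_mul]
      exact (hL _ ht).norm_sub_apply_le (hρ _ ht).2 a b
    exact (ho.isBigO.hasFDerivAt one_lt_two).hasDerivAt
  have hsum := hsing.add hEρE
  refine (hsum.congr_deriv ?_).congr_of_eventuallyEq (Eventually.of_forall fun t => ?_)
  · simp only [zero_smul, hL0, smul_zero, NormedSpace.exp_zero, mul_one, one_mul, zero_add,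
      Matrix.smul_mul, Matrix.mul_smul, smul_add]
    rw [add_comm]
  · simp

theorem fderiv_apply_eq_sum (L : Param d → Matrix D D ℂ) (h : Param d) :
    fderiv ℝ L 0 h = ∑ i, (h i : ℂ) • fderiv ℝ L 0 (EuclideanSpace.single i (1 : ℝ)) := by
  have h1 : h = ∑ i, h i • EuclideanSpace.single i (1 : ℝ) := by
    simpa using ((EuclideanSpace.basisFun (Fin d) ℝ).sum_repr h).symm
  conv_lhs => rw [h1, map_sum]
  refine Finset.sum_congr rfl fun i _ => ?_
  rw [map_smul, Complex.coe_smul]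

theorem IsSLD.deriv_coordCurve {θ₀ : Param d} {ρ : Param d → Matrix D D ℂ} {i : Fin d}
    {A : Matrix D D ℂ} (hA : IsSLD ρ θ₀ i A) :
    deriv (coordCurve ρ θ₀ i) 0 = (1 / 2 : ℂ) • (ρ θ₀ * A + A * ρ θ₀) :=
  HasDerivAt.deriv hA.2

/-- Two versions of a symmetric logarithmic derivative agree on the support of the state. -/
theorem IsSLD.mul_sub_eq_zero {θ₀ : Param d} {ρ : Param d → Matrix D D ℂ}
    (hρ : (ρ θ₀).PosSemidef) {i : Fin d} {A B : Matrix D D ℂ} (hA : IsSLD ρ θ₀ i A)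
    (hB : IsSLD ρ θ₀ i B) : ρ θ₀ * (A - B) = 0 := by
  refine mul_eq_zero_of_anticommute hρ (hA.1.sub hB.1) ?_
  have h := hA.2.unique hB.2
  have h' := smul_right_injective (Matrix D D ℂ) (show (1 / 2 : ℂ) ≠ 0 by norm_num) h
  rw [Matrix.mul_sub, Matrix.sub_mul, ← sub_eq_zero.2 h']
  abel

theorem isInfinitesimal_siteSum_sub {θ₀ : Param d} {ρ : Param d → Matrix D D ℂ}
    (hρ : IsDensity (ρ θ₀)) {L : Param d → Matrix D D ℂ}
    (hL0 : L 0 = 0) (hdiff : DifferentiableAt ℝ L 0)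
    (htrace : (fun h => (ρ θ₀ * NormedSpace.exp (L h)).trace - 1)
      =o[𝓝 (0 : Param d)] fun h => ‖h‖ ^ 2)
    (hB : ∀ i, IsSLD ρ θ₀ i (fderiv ℝ L 0 (EuclideanSpace.single i (1 : ℝ))))
    {A : Fin d → Matrix D D ℂ} (hA : ∀ i, IsSLD ρ θ₀ i (A i)) (h : Param d) :
    IsInfinitesimal (D := fun n => Fin n → D) (fun n i => normalizedSum n (A i))
      (fun n => tensorPow n (ρ θ₀)) (covMatrix (ρ θ₀) A) fun n =>
      siteSum n (L ((Real.sqrt n)⁻¹ • h)) - ((∑ i, (h i : ℂ) • normalizedSum n (A i))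
        - ((1 / 2 : ℂ) * ∑ i, ∑ j, covMatrix (ρ θ₀) A i j * (h i : ℂ) * (h j : ℂ)) •
          (1 : Matrix (Fin n → D) (Fin n → D) ℂ)) := by
  set HA : Matrix D D ℂ := ∑ i, (h i : ℂ) • A i with hHA
  set c : ℂ := ∑ i, ∑ j, covMatrix (ρ θ₀) A i j * (h i : ℂ) * (h j : ℂ) with hcdef
  set B : Matrix D D ℂ := fderiv ℝ L 0 h with hBdef
  have hρAB : ∀ i, ρ θ₀ * (A i - fderiv ℝ L 0 (EuclideanSpace.single i (1 : ℝ))) = 0 := fun i =>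
    (hA i).mul_sub_eq_zero hρ.1 (hB i)
  have hW : B - HA = ∑ i, (h i : ℂ) •
      (fderiv ℝ L 0 (EuclideanSpace.single i (1 : ℝ)) - A i) := by
    rw [hBdef, fderiv_apply_eq_sum, hHA, ← Finset.sum_sub_distrib]
    exact Finset.sum_congr rfl fun i _ => (smul_sub _ _ _).symm
  have hρW : ρ θ₀ * (B - HA) = 0 := by
    rw [hW, Matrix.mul_sum]
    refine Finset.sum_eq_zero fun i _ => ?_
    rw [Matrix.mul_smul, ← neg_sub, Matrix.mul_neg, hρAB, neg_zero, smul_zero]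
  have hWH : (B - HA).IsHermitian := by
    rw [hW, Matrix.IsHermitian,
      conjTranspose_sum_smul fun i => (hB i).1.sub (hA i).1]
    simp
  have hWρ : (B - HA) * ρ θ₀ = 0 := by
    have := congrArg Matrix.conjTranspose hρW
    rwa [Matrix.conjTranspose_mul, hWH.eq, hρ.1.isHermitian.eq, Matrix.conjTranspose_zero] at this
  -- The mean depends only on `ρ Aᵢ`, which is the same for all SLD versions.
  have hAtr : ∀ i, (ρ θ₀ * A i).trace = 0 := fun i => by
    have h1 := hρAB i
    rw [Matrix.mul_sub, sub_eq_zero] at h1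
    rw [h1]
    exact trace_mul_fderiv_eq_zero hρ.2 hL0 hdiff htrace _
  have hHAtr : (ρ θ₀ * HA).trace = 0 := by
    simp [hHA, Matrix.mul_sum, Matrix.trace_sum, hAtr]
  -- `B` and `HA` agree after multiplication by `ρ` on either side, so `c` matches the second order
  -- term of `Tr ρ L`.
  have hc : (ρ θ₀ * (B * B)).trace = c := by
    have h1 : ρ θ₀ * B = ρ θ₀ * HA := by rwa [Matrix.mul_sub, sub_eq_zero] at hρW
    have h2 : B * ρ θ₀ = HA * ρ θ₀ := by rwa [Matrix.sub_mul, sub_eq_zero] at hWρ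
    rw [← Matrix.mul_assoc, h1, Matrix.trace_mul_comm, ← Matrix.mul_assoc, h2,
      Matrix.mul_assoc, Matrix.trace_mul_comm, hHA, trace_mul_mul_sum, hcdef, Finset.sum_comm]
    exact Finset.sum_congr rfl fun i _ => Finset.sum_congr rfl fun j _ => by ring
  have hsh : Tendsto (fun n : ℕ => (Real.sqrt n)⁻¹ • h) atTop (𝓝 0) := by
    simpa using tendsto_inv_sqrt_natCast.smul_const h
  have hnorm : (fun n : ℕ => ‖(Real.sqrt n)⁻¹ • h‖) =O[atTop] fun n : ℕ => (Real.sqrt n)⁻¹ :=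
    IsBigO.of_bound ‖h‖ (Eventually.of_forall fun n => by
      rw [norm_norm, norm_smul, mul_comm])
  -- One site's share of the remainder: the scalar `c/2` is split into `n` equal parts.
  set V : ℕ → Matrix D D ℂ := fun n => L ((Real.sqrt n)⁻¹ • h)
    - (((Real.sqrt n)⁻¹ : ℝ) : ℂ) • HA
    + ((1 / 2 : ℂ) * c * (((Real.sqrt n)⁻¹ : ℝ) : ℂ) ^ 2) • (1 : Matrix D D ℂ) with hVdef
  have hsq : (fun n : ℕ => ((1 / 2 : ℂ) * c * (((Real.sqrt n)⁻¹ : ℝ) : ℂ) ^ 2) •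
      (1 : Matrix D D ℂ)) =o[atTop] fun n : ℕ => (Real.sqrt n)⁻¹ := by
    have h1 : (fun n : ℕ => (Real.sqrt n)⁻¹ ^ 2) =o[atTop] fun n : ℕ => (Real.sqrt n)⁻¹ ^ 1 :=
      (isLittleO_pow_pow (𝕜 := ℝ) one_lt_two).comp_tendsto tendsto_inv_sqrt_natCast
    simp only [pow_one] at h1
    refine IsBigO.trans_isLittleO (IsBigO.of_bound (‖(1 / 2 : ℂ) * c‖ * ‖(1 : Matrix D D ℂ)‖)
      (Eventually.of_forall fun n => ?_)) h1
    rw [norm_smul, norm_mul, norm_pow, Complex.norm_real, norm_pow]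
    exact le_of_eq (by ring)
  have hVW : (fun n => V n - (((Real.sqrt n)⁻¹ : ℝ) : ℂ) • (B - HA)) =o[atTop]
      fun n : ℕ => (Real.sqrt n)⁻¹ := by
    have h1 := (hdiff.hasFDerivAt.isLittleO.norm_right.comp_tendsto hsh).trans_isBigO
      (hnorm.congr_left fun n => by simp)
    refine (h1.add hsq).congr_left fun n => ?_
    have h2 : fderiv ℝ L 0 ((Real.sqrt n)⁻¹ • h) = (((Real.sqrt n)⁻¹ : ℝ) : ℂ) • B := by
      rw [map_smul, Complex.coe_smul]
    simp only [Function.comp_apply, sub_zero, hL0, hVdef]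
    erw [h2]
    rw [smul_sub]
    abel
  have hV : (fun n => (ρ θ₀ * V n).trace) =o[atTop] fun n : ℕ => (Real.sqrt n)⁻¹ ^ 2 := by
    have h1 := ((trace_mul_logLikelihood_isLittleO hρ.2 hL0 hdiff htrace).comp_tendsto
      hsh).trans_isBigO (hnorm.pow 2)
    refine h1.congr_left fun n => ?_
    simp only [Function.comp_apply, hVdef, Matrix.mul_add, Matrix.mul_sub, Matrix.mul_smul,
      Matrix.mul_one, Matrix.trace_add, Matrix.trace_sub, Matrix.trace_smul, smul_eq_mul, hHAtr,
      hρ.2]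
    have h2 : fderiv ℝ L 0 ((Real.sqrt n)⁻¹ • h) = (((Real.sqrt n)⁻¹ : ℝ) : ℂ) • B := by
      rw [map_smul, Complex.coe_smul]
    rw [h2, smul_mul_smul_comm, Matrix.mul_smul, Matrix.trace_smul, hc, smul_eq_mul]
    ring
  have key := isInfinitesimal_siteSum hρ.2 hAtr hρW hWρ hVW hV
  intro r ξ η
  refine (key r ξ η).congr' ?_
  -- At `n = 0` the empty site sum would not produce the constant `c/2`.
  filter_upwards [eventually_gt_atTop 0] with n hn
  have hn' : (n : ℂ) ≠ 0 := by exact_mod_cast hn.ne'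
  have hR : siteSum n (V n) = siteSum n (L ((Real.sqrt n)⁻¹ • h))
      - ((∑ i, (h i : ℂ) • normalizedSum n (A i)) - ((1 / 2 : ℂ) * c) •
          (1 : Matrix (Fin n → D) (Fin n → D) ℂ)) := by
    have h1 : ((((Real.sqrt n)⁻¹ : ℝ) : ℂ)) ^ 2 * n = 1 := by
      rw [← Complex.ofReal_pow, inv_pow, Real.sq_sqrt (Nat.cast_nonneg n)]
      push_cast
      exact inv_mul_cancel₀ hn'
    rw [← siteSumLinear_apply, hVdef]
    simp only [map_add, map_sub, map_smul, map_sum, siteSumLinear_apply, siteSum_one, hHA,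
      normalizedSum, smul_smul, mul_assoc, h1, mul_one, Finset.smul_sum]
    rw [sub_sub_eq_add_sub, sub_add_eq_add_sub]
    congr 2
    exact funext fun i => by rw [mul_comm]
  rw [hR]

end Model

end QLAN

/-! ### Assembly of the theorem -/

theorem mainTheorem2 {d : ℕ} {D : Type*} [Fintype D] [DecidableEq D]
    (Θ : Set (QLAN.Param d)) (hΘ : IsOpen Θ) (θ₀ : QLAN.Param d) (hθ₀ : θ₀ ∈ Θ)
    (ρ : QLAN.Param d → Matrix D D ℂ) (hρ : ∀ θ ∈ Θ, QLAN.IsDensity (ρ θ))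
    (hac : ∀ θ ∈ Θ, QLAN.AbsCont (ρ θ₀) (ρ θ))
    -- `L h` is a version of the quantum log-likelihood ratio, normalized by `𝓛(ρ | ρ) = 0`
    (L : QLAN.Param d → Matrix D D ℂ)
    (hL : ∀ h, θ₀ + h ∈ Θ → QLAN.IsLogLikelihoodRatio (ρ (θ₀ + h)) (ρ θ₀) (L h))
    (hL0 : L 0 = 0)
    (hdiff : DifferentiableAt ℝ L 0)
    (htrace : (fun h => (ρ θ₀ * NormedSpace.exp (L h)).trace - 1)
      =o[𝓝 (0 : QLAN.Param d)] fun h => ‖h‖ ^ 2) :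
    -- the log-likelihood ratio of the tensor powers is the sum of the single-site ratios
    (∀ (n : ℕ), ∀ θ ∈ Θ, ∀ M : Matrix D D ℂ, QLAN.IsLogLikelihoodRatio (ρ θ) (ρ θ₀) M →
      QLAN.IsLogLikelihoodRatio (QLAN.tensorPow n (ρ θ)) (QLAN.tensorPow n (ρ θ₀))
        (QLAN.siteSum n M)) ∧
    -- the partial derivatives of `L` at `0` are versions of the SLDs
    (∀ i, QLAN.IsSLD ρ θ₀ i (fderiv ℝ L 0 (EuclideanSpace.single i (1 : ℝ)))) ∧
    -- for all versions `A i` of the SLDs the tensor powers are q-LAN (with `Re J > 0` exactly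
    -- where the partial derivatives of the model at `θ₀` are linearly independent)
    ∀ A : Fin d → Matrix D D ℂ, (∀ i, QLAN.IsSLD ρ θ₀ i (A i)) →
      QLAN.HasQLANExpansion Θ θ₀ (fun n θ => QLAN.tensorPow n (ρ θ))
        (fun n i => QLAN.normalizedSum n (A i)) (QLAN.covMatrix (ρ θ₀) A)
        (fun n h => QLAN.siteSum n (L ((Real.sqrt n)⁻¹ • h))) ∧
      (QLAN.IsQLAN Θ θ₀ (fun n θ => QLAN.tensorPow n (ρ θ))
        (fun n i => QLAN.normalizedSum n (A i)) (QLAN.covMatrix (ρ θ₀) A)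
        (fun n h => QLAN.siteSum n (L ((Real.sqrt n)⁻¹ • h))) ↔
        LinearIndependent ℝ fun i => deriv (QLAN.coordCurve ρ θ₀ i) 0) := by
  have hρ₀ := hρ θ₀ hθ₀
  have hSLD := QLAN.isSLD_fderiv hΘ hθ₀ hρ hL hL0 hdiff htrace
  have htensor : ∀ (n : ℕ), ∀ θ ∈ Θ, ∀ M : Matrix D D ℂ,
      QLAN.IsLogLikelihoodRatio (ρ θ) (ρ θ₀) M →
      QLAN.IsLogLikelihoodRatio (QLAN.tensorPow n (ρ θ)) (QLAN.tensorPow n (ρ θ₀))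
        (QLAN.siteSum n M) := fun n θ _ M hM => hM.siteSum hρ₀.1 n
  have hL' : ∀ θ ∈ Θ, QLAN.IsLogLikelihoodRatio (ρ θ) (ρ θ₀) (L (θ - θ₀)) := fun θ hθ => by
    have h := hL (θ - θ₀) (by rwa [add_sub_cancel])
    rwa [add_sub_cancel] at h
  refine ⟨htensor, hSLD, fun A hA => ?_⟩
  have hexpansion := QLAN.isInfinitesimal_siteSum_sub hρ₀ hL0 hdiff htrace hSLD hA
  have hqlan : QLAN.HasQLANExpansion Θ θ₀ (fun n θ => QLAN.tensorPow n (ρ θ))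
      (fun n i => QLAN.normalizedSum n (A i)) (QLAN.covMatrix (ρ θ₀) A)
      (fun n h => QLAN.siteSum n (L ((Real.sqrt n)⁻¹ • h))) :=
    { isOpen := hΘ
      mem := hθ₀
      density := fun n θ hθ => (hρ θ hθ).tensorPow n
      -- The tensor power dominates its absolutely continuous part `E ρ E` with `E > 0`, which is
      -- strictly positive on the support.
      absCont := fun n θ hθ =>
        (htensor n θ hθ _ (hL' θ hθ)).absCont (hρ₀.tensorPow n).1
      observable := fun n i => by
        rw [Matrix.IsHermitian, QLAN.normalizedSum, Matrix.conjTranspose_smul,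
          (QLAN.isHermitian_siteSum n (hA i).1).eq]
        simp
      posSemidef := QLAN.posSemidef_covMatrix hρ₀.1 fun i => (hA i).1
      -- With `η = 0` the remainder disappears from the exponents, so any `h` would do.
      convergesInLaw := fun r ξ => by
        simpa using hexpansion 0 r ξ 0
      logLikelihoodRatio := fun n h hh => htensor n _ hh _ (hL _ hh)
      logLikelihoodRatio_zero := fun n => by
        rw [smul_zero, hL0, ← QLAN.siteSumLinear_apply, map_zero]
      expansion := hexpansion }
  refine ⟨hqlan, ?_⟩
  have hderiv : (fun i => deriv (QLAN.coordCurve ρ θ₀ i) 0)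
      = fun i => (1 / 2 : ℂ) • (ρ θ₀ * A i + A i * ρ θ₀) := funext fun i => (hA i).deriv_coordCurve
  rw [hderiv, ← QLAN.posDef_re_covMatrix_iff hρ₀.1 fun i => (hA i).1]
  exact ⟨fun h => h.posDef_re, fun h => { hqlan with posDef_re := h }⟩

end
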